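/- **Definitions.** A *$\mathbb{Z}$-flat $\Lambda$-scheme* is a scheme $X$, flat over $\operatorname{Spec}\mathbb{Z}$, together with pairwise commuting endomorphisms $\psi_p : X \to X$, one for each prime $p$, such that $\psi_p$ induces the absolute ($p$-power) Frobenius on $X \times \operatorname{Spec}\mathbb{F}_p$. A morphism $f : Y \to X$ of such schemes is *$\Lambda$-equivariant* if $f\circ\psi_{p,Y} = \psi_{p,X}\circ f$ for all primes $p$. An open subscheme $V \subset X$ is an *open $\Lambda$-subscheme* if $\psi_p(V)\subset V$ for all $p$; it is then itself a $\mathbb{Z}$-flat $\Lambda$-scheme with the restrictions of the $\psi_p$. An *affine $\Lambda$-cover* of a $\mathbb{Z}$-flat $\Lambda$-scheme $X$ is an open cover $X = \bigcup_i U_i$ by affine open $\Lambda$-subschemes $U_i = \operatorname{Spec} A_i$ such that each intersection $U_i\cap U_j$ is covered by open $\Lambda$-subschemes of $X$ that are distinguished (i.e. principal) open subsets of both $U_i$ and $U_j$. Given an affine $\Lambda$-cover $(U_i = \operatorname{Spec} A_i)_i$ of $X$, a quasi-coherent ideal sheaf $\mathcal{I}\subset\mathcal{O}_X$ is *locally toric*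 for the cover if, for every $i$, the ideal $\mathcal{I}(U_i)\subset A_i$ is generated by finitely many elements $x_1,\dots,x_{n_i}$ with $\psi_p(x_k) = x_k^p$ for all $k$ and all primes $p$, where $\psi_p : A_i\to A_i$ is the induced Frobenius lift. The *normal cone* of $\mathcal{I}$ is the relative spectrum over $X$ of $\bigoplus_{n\ge 0}\mathcal{I}^n/\mathcal{I}^{n+1}$; it is $\mathbb{Z}$-flat if $\bigoplus_{n \ge 0} \mathcal{I}(U)^n/\mathcal{I}(U)^{n+1}$ is a flat $\mathbb{Z}$-module for every affine open $U \subset X$. The *blow-up* of $X$ along the closed subscheme $Z$ defined by $\mathcal{I}$ is the relative Proj $\pi : B_Z X = \operatorname{Proj}_X\bigl(\bigoplus_{n\ge 0}\mathcal{I}^n\bigr)\to X$. **Proposition (Gluing blow-up $\Lambda$-structures).** Let $X$ be a $\mathbb{Z}$-flat $\Lambda$-scheme with an affine $\Lambda$-cover. Let $Z\subset X$ be a closed subscheme defined by a quasi-coherent ideal sheaf $\mathcal{I}\subset\mathcal{O}_X$ that is locally toric for the cover and whose normal cone is $\mathbb{Z}$-flat. Then the blow-up $B_Z X$ is flat over $\mathbb{Z}$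 and carries the structure of a $\mathbb{Z}$-flat $\Lambda$-scheme for which the blow-up morphism $\pi : B_Z X\to X$ is $\Lambda$-equivariant and which admits an affine $\Lambda$-cover. -/

import Mathlib

universe u

open CategoryTheory AlgebraicGeometry

noncomputable section

section Rees

open Limits Polynomial

variable {A : Type u} [CommRing A] (I : Ideal A)

/-- The homogeneous elements `a tⁿ` (`a ∈ Iⁿ`) of degree `n` in the Rees algebra `A[It] ⊆ A[t]`. -/
def reesGrading (n : ℕ) : Submodule A (reesAlgebra I) :=
  (LinearMap.range (monomial n : A →ₗ[A] A[X])).comap (reesAlgebra I).val.toLinearMap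

lemma mem_reesGrading {n : ℕ} {f : reesAlgebra I} :
    f ∈ reesGrading I n ↔ monomial n (f.1.coeff n) = f.1 := by
  constructor
  · rintro ⟨a, ha⟩
    change monomial n a = f.1 at ha
    rw [← ha]; simp
  · intro h; exact ⟨_, h⟩

lemma monomial_mem_reesGrading {n : ℕ} {a : A} (ha : a ∈ I ^ n) :
    (⟨monomial n a, reesAlgebra.monomial_mem.2 ha⟩ : reesAlgebra I) ∈ reesGrading I n :=
  ⟨a, rfl⟩

instance : SetLike.GradedMonoid (reesGrading I) where
  one_mem := ⟨1, rfl⟩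
  mul_mem i j f g := by
    rintro ⟨a, ha⟩ ⟨b, hb⟩
    refine ⟨a * b, ?_⟩
    rw [← monomial_mul_monomial, ha, hb]; rfl

lemma coeff_coeAddMonoidHom (x : DirectSum ℕ fun i => reesGrading I i) (i : ℕ) :
    (DirectSum.coeAddMonoidHom (reesGrading I) x).1.coeff i = (x i).1.1.coeff i := by
  induction x using DirectSum.induction_on with
  | zero => simp
  | of j y =>
    rw [DirectSum.coeAddMonoidHom_of]
    by_cases h : i = j
    · subst h; simp
    · rw [DirectSum.of_eq_of_ne _ _ _ h, ← (mem_reesGrading I).1 y.2,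
        coeff_monomial, if_neg (Ne.symm h)]
      simp
  | add x y hx hy => simp [hx, hy]

/-- The component `(f.coeff n) tⁿ` of an element of the Rees algebra. -/
def reesComponent (n : ℕ) (f : reesAlgebra I) : reesGrading I n :=
  ⟨⟨monomial n (f.1.coeff n), reesAlgebra.monomial_mem.2 (f.2 n)⟩, ⟨_, rfl⟩⟩

instance : GradedAlgebra (reesGrading I) where
  decompose' f := DirectSum.mk _ f.1.support fun n => reesComponent I n.1 f
  left_inv f := by
    apply Subtype.ext
    ext i
    rw [coeff_coeAddMonoidHom]
    by_cases h : i ∈ f.1.support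
    · rw [DirectSum.mk_apply_of_mem h]; simp [reesComponent]
    · rw [DirectSum.mk_apply_of_notMem h]; simpa using (notMem_support_iff.1 h).symm
  right_inv x := by
    refine DFinsupp.ext fun i => ?_
    apply Subtype.ext
    apply Subtype.ext
    have key := coeff_coeAddMonoidHom I x i
    have hx := (mem_reesGrading I).1 (x i).2
    by_cases h : i ∈ (DirectSum.coeAddMonoidHom (reesGrading I) x).1.support
    · rw [DirectSum.mk_apply_of_mem h]
      simp only [reesComponent]
      rw [key, hx]
    · rw [DirectSum.mk_apply_of_notMem h]
      rw [notMem_support_iff, key] at h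
      rw [← hx, h]; simp

variable {B : Type u} [CommRing B] (φ : A →+* B)

/-- The graded map of Rees algebras `∑ aₙ tⁿ ↦ ∑ φ(aₙ) tⁿ`, for `I B = J`. -/
def reesMap {I : Ideal A} {J : Ideal B} (h : I.map φ = J) :
    GradedRingHom (reesGrading I) (reesGrading J) where
  __ := ((mapRingHom φ).comp (reesAlgebra I).val.toRingHom).codRestrict (reesAlgebra J).toSubring
    fun f i => by
      have := Ideal.mem_map_of_mem φ (f.2 i)
      rw [Ideal.map_pow, h] at this
      simpa using this
  map_mem {i x} := by
    rintro ⟨a, ha⟩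
    refine ⟨φ a, ?_⟩
    change monomial i a = x.1 at ha
    change monomial i (φ a) = x.1.map φ
    rw [← ha]; simp

lemma coe_reesMap {I : Ideal A} {J : Ideal B} (h : I.map φ = J) (x : reesAlgebra I) :
    (reesMap φ h x).1 = x.1.map φ := rfl

lemma irrelevant_le_map_reesMap {I : Ideal A} {J : Ideal B} (h : I.map φ = J) :
    HomogeneousIdeal.irrelevant (reesGrading J) ≤
      (HomogeneousIdeal.irrelevant (reesGrading I)).map (reesMap φ h) := by
  refine (HomogeneousIdeal.toIdeal_irrelevant_le (reesGrading J)).2 ?_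
  intro n hn x hx
  change x ∈ reesGrading J n at hx
  rw [mem_reesGrading] at hx
  have hc : x.1.coeff n ∈ Ideal.map φ (I ^ n) := by
    rw [Ideal.map_pow, h]; exact x.2 n
  have key : ∀ (c : B) (hc : c ∈ Ideal.map φ (I ^ n)) (y : reesAlgebra J), y.1 = monomial n c →
      y ∈ ((HomogeneousIdeal.irrelevant (reesGrading I)).map (reesMap φ h)).toIdeal := by
    intro c hc
    rw [Ideal.map] at hc
    induction hc using Submodule.span_induction with
    | mem c hc =>
      obtain ⟨a, ha, rfl⟩ := hc
      intro y hy
      let z : reesAlgebra I := ⟨monomial n a, reesAlgebra.monomial_mem.2 ha⟩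
      have : y = reesMap φ h z := by
        apply Subtype.ext; rw [coe_reesMap, hy]; simp [z]
      rw [this]
      exact Ideal.mem_map_of_mem _ (HomogeneousIdeal.mem_irrelevant_of_mem _ hn ⟨a, rfl⟩)
    | zero =>
      intro y hy
      have : y = 0 := Subtype.ext (by simpa using hy)
      rw [this]; exact zero_mem _
    | add c d hc hd ihc ihd =>
      intro y hy
      have hc' : c ∈ J ^ n := by rw [← h, ← Ideal.map_pow]; exact hc
      have hd' : d ∈ J ^ n := by rw [← h, ← Ideal.map_pow]; exact hd
      have : y = ⟨monomial n c, reesAlgebra.monomial_mem.2 hc'⟩ +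
          ⟨monomial n d, reesAlgebra.monomial_mem.2 hd'⟩ :=
        Subtype.ext (by rw [hy]; simp)
      rw [this]
      exact add_mem (ihc _ rfl) (ihd _ rfl)
    | smul b c hc ihc =>
      intro y hy
      have hc' : c ∈ J ^ n := by rw [← h, ← Ideal.map_pow]; exact hc
      have : y = algebraMap B (reesAlgebra J) b *
          ⟨monomial n c, reesAlgebra.monomial_mem.2 hc'⟩ :=
        Subtype.ext (by rw [hy]; change _ = C b * monomial n c; simp [C_mul_monomial])
      rw [this]
      exact Ideal.mul_mem_left _ _ (ihc _ rfl)
  exact key _ hc x hx.symm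


/-- The structure morphism `Proj A[It] ⟶ Spec A`. -/
def projReesToSpec : Proj (reesGrading I) ⟶ Spec (.of A) :=
  Proj.toSpecZero (reesGrading I) ≫
    Spec.map (CommRingCat.ofHom (algebraMap A (reesGrading I 0)))

/-- The structure map `A ⟶ A[It]_(s)`. -/
def awayStr (s : reesAlgebra I) : A →+* HomogeneousLocalization.Away (reesGrading I) s :=
  (HomogeneousLocalization.fromZeroRingHom (reesGrading I) _).comp
    (algebraMap A (reesGrading I 0))

lemma val_awayStr (s : reesAlgebra I) (a : A) :
    (awayStr I s a).val = Localization.mk (algebraMap A (reesAlgebra I) a) 1 := rfl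

lemma awayι_projReesToSpec {s : reesAlgebra I} {i : ℕ} (hs : s ∈ reesGrading I i) (hi : 0 < i) :
    Proj.awayι (reesGrading I) s hs hi ≫ projReesToSpec I =
      Spec.map (CommRingCat.ofHom (awayStr I s)) := by
  rw [projReesToSpec, ← Category.assoc, Proj.awayι_toSpecZero, ← Spec.map_comp]
  rfl

lemma map_awayStr {I : Ideal A} {J : Ideal B} (h : I.map φ = J) (s : reesAlgebra I) :
    (HomogeneousLocalization.Away.map (reesMap φ h) s).comp (awayStr I s) =
      (awayStr J (reesMap φ h s)).comp φ := by
  ext a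
  change Localization.mk (reesMap φ h (algebraMap A (reesAlgebra I) a)) (⟨reesMap φ h 1, _⟩) = 
    Localization.mk (algebraMap B (reesAlgebra J) (φ a)) 1
  congr 1
  · apply Subtype.ext; rw [coe_reesMap]; change (C a).map φ = C (φ a); simp
  · apply Subtype.ext; simp

/-- The morphism `Proj B[Jt] ⟶ Proj A[It]` induced by `φ : A → B` when `J = I B`. -/
def projReesMap {I : Ideal A} {J : Ideal B} (h : I.map φ = J) :
    Proj (reesGrading J) ⟶ Proj (reesGrading I) :=
  Proj.map (reesMap φ h) (irrelevant_le_map_reesMap φ h)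

lemma projReesMap_toSpec {I : Ideal A} {J : Ideal B} (h : I.map φ = J) :
    projReesMap φ h ≫ projReesToSpec I =
      projReesToSpec J ≫ Spec.map (CommRingCat.ofHom φ) := by
  have key {i : ℕ} (hi : 0 < i) {s : reesAlgebra I} (hs : s ∈ reesGrading I i) :
      Proj.awayι (reesGrading J) (reesMap φ h s) ((reesMap φ h).2 hs) hi ≫
        projReesMap φ h ≫ projReesToSpec I =
      Proj.awayι (reesGrading J) (reesMap φ h s) ((reesMap φ h).2 hs) hi ≫
        projReesToSpec J ≫ Spec.map (CommRingCat.ofHom φ) := by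
    rw [projReesMap, Proj.awayι_comp_map_assoc (reesMap φ h) _ hi s hs,
      awayι_projReesToSpec I hs hi, ← Category.assoc, awayι_projReesToSpec J,
      ← Spec.map_comp, ← Spec.map_comp]
    congr 1
    rw [← CommRingCat.ofHom_comp, ← CommRingCat.ofHom_comp, map_awayStr]
  exact (Proj.mapAffineOpenCover _ (irrelevant_le_map_reesMap φ h)).openCover.hom_ext _ _
    fun s => key s.1.2 s.2.2

lemma away_map_awayStr {I : Ideal A} {J : Ideal B} (h : I.map φ = J) (s : reesAlgebra I) (a : A) :
    HomogeneousLocalization.Away.map (reesMap φ h) s (awayStr I s a) =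
      awayStr J (reesMap φ h s) (φ a) :=
  DFunLike.congr_fun (map_awayStr φ h s) a

lemma exists_pow_mul_eq {R S : Type*} [CommRing R] [CommRing S] (g : R →+* S) (r : R)
    (H : ∀ d, g d = 0 → ∃ n : ℕ, r ^ n * d = 0) (a b : R) (hab : g a = g b) :
    ∃ n : ℕ, r ^ n * a = r ^ n * b := by
  obtain ⟨n, hn⟩ := H (a - b) (by rw [map_sub, hab, sub_self])
  exact ⟨n, by rwa [mul_sub, sub_eq_zero] at hn⟩

lemma isLocalization_away_map (f : A) [Algebra A B] [IsLocalization.Away f B] {I : Ideal A}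
    {J : Ideal B} (h : I.map (algebraMap A B) = J) {s : reesAlgebra I} {i : ℕ}
    (hs : s ∈ reesGrading I i) :
    letI := (HomogeneousLocalization.Away.map (reesMap (algebraMap A B) h) s).toAlgebra
    IsLocalization.Away (awayStr I s f)
      (HomogeneousLocalization.Away (reesGrading J) (reesMap (algebraMap A B) h s)) := by
  let := (HomogeneousLocalization.Away.map (reesMap (algebraMap A B) h) s).toAlgebra
  have hs' := (reesMap (algebraMap A B) h).2 hs
  refine IsLocalization.Away.mk (awayStr I s f) ?_ ?_ ?_
  · rw [RingHom.algebraMap_toAlgebra, away_map_awayStr]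
    exact (IsLocalization.Away.algebraMap_isUnit f).map _
  · intro y
    obtain ⟨n, x, hx, rfl⟩ := HomogeneousLocalization.Away.mk_surjective _ hs' y
    have hx' := (mem_reesGrading J).1 hx
    have hc : x.1.coeff (n • i) ∈ Ideal.map (algebraMap A B) (I ^ (n • i)) := by
      rw [Ideal.map_pow, h]; exact x.2 _
    obtain ⟨⟨⟨a, ha⟩, ⟨_, k, rfl⟩⟩, hak⟩ :=
      (IsLocalization.mem_map_algebraMap_iff (Submonoid.powers f) B).1 hc
    refine ⟨k, HomogeneousLocalization.Away.mk _ hs n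
      _ (monomial_mem_reesGrading I ha), ?_⟩
    rw [RingHom.algebraMap_toAlgebra, away_map_awayStr]
    rw [HomogeneousLocalization.Away.map_mk]
    apply HomogeneousLocalization.val_injective
    rw [HomogeneousLocalization.val_mul, HomogeneousLocalization.val_pow, val_awayStr,
      HomogeneousLocalization.Away.val_mk, HomogeneousLocalization.Away.val_mk,
      Localization.mk_pow, Localization.mk_mul]
    congr 1
    · apply Subtype.ext
      rw [coe_reesMap]
      change x.1 * (C (algebraMap A B f)) ^ k = (monomial (n • i) a).map _
      rw [← hx', Polynomial.map_monomial, ← C_pow, monomial_mul_C]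
      congr 1
      simpa using hak
    · simp
  · refine exists_pow_mul_eq (HomogeneousLocalization.Away.map (reesMap (algebraMap A B) h) s)
      (awayStr I s f) fun d hd => ?_
    obtain ⟨n, x, hx, rfl⟩ := HomogeneousLocalization.Away.mk_surjective _ hs d
    rw [HomogeneousLocalization.Away.map_mk] at hd
    have hd' := congrArg HomogeneousLocalization.val hd
    rw [HomogeneousLocalization.Away.val_mk, HomogeneousLocalization.val_zero,
      Localization.mk_eq_mk', IsLocalization.mk'_eq_zero_iff] at hd'
    obtain ⟨⟨_, m, rfl⟩, hm⟩ := hd'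
    have hm' : reesMap (algebraMap A B) h (s ^ m * x) = 0 := by
      rw [← hm]; simp
    have hdeg : s ^ m * x ∈ reesGrading I (m • i + n • i) :=
      SetLike.mul_mem_graded (SetLike.pow_mem_graded m hs) hx
    have hdeg' := (mem_reesGrading I).1 hdeg
    have hz : algebraMap A B ((s ^ m * x).1.coeff (m • i + n • i)) = 0 := by
      have : (reesMap (algebraMap A B) h (s ^ m * x)).1.coeff (m • i + n • i) = 0 := by
        rw [hm']; rfl
      rwa [coe_reesMap, coeff_map] at this
    obtain ⟨⟨_, k, rfl⟩, hk⟩ := (IsLocalization.map_eq_zero_iff (Submonoid.powers f) B _).1 hz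
    refine ⟨k, ?_⟩
    apply HomogeneousLocalization.val_injective
    rw [HomogeneousLocalization.val_mul, HomogeneousLocalization.val_pow, val_awayStr,
      HomogeneousLocalization.Away.val_mk, HomogeneousLocalization.val_zero,
      Localization.mk_pow, Localization.mk_mul, Localization.mk_eq_mk',
      IsLocalization.mk'_eq_zero_iff]
    refine ⟨⟨_, m, rfl⟩, ?_⟩
    apply Subtype.ext
    change (s ^ m).1 * ((C f) ^ k * x.1) = 0
    have : (s ^ m).1 * x.1 = monomial (m • i + n • i) ((s ^ m * x).1.coeff (m • i + n • i)) :=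
      hdeg'.symm
    rw [mul_left_comm, this, ← C_pow, C_mul_monomial]
    simp only at hk
    rw [hk, map_zero]

lemma isPullback_awayι {I : Ideal A} {J : Ideal B} (h : I.map φ = J) {s : reesAlgebra I} {i : ℕ}
    (hs : s ∈ reesGrading I i) (hi : 0 < i) :
    IsPullback (Spec.map (CommRingCat.ofHom (HomogeneousLocalization.Away.map (reesMap φ h) s)))
      (Proj.awayι (reesGrading J) (reesMap φ h s) ((reesMap φ h).2 hs) hi)
      (Proj.awayι (reesGrading I) s hs hi) (projReesMap φ h) := by
  refine IsOpenImmersion.isPullback _ _ _ _ (Proj.awayι_comp_map _ _ hi s hs) ?_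
  rw [Proj.opensRange_awayι, Proj.opensRange_awayι]
  rfl

lemma isOpenImmersion_projReesMap (f : A) [Algebra A B] [IsLocalization.Away f B] {I : Ideal A}
    {J : Ideal B} (h : I.map (algebraMap A B) = J) :
    IsOpenImmersion (projReesMap (algebraMap A B) h) := by
  rw [IsZariskiLocalAtTarget.iff_of_openCover (P := @IsOpenImmersion)
    (Proj.affineOpenCover (reesGrading I)).openCover]
  intro s
  have hp := isPullback_awayι (algebraMap A B) h s.2.2 s.1.2
  let := (HomogeneousLocalization.Away.map (reesMap (algebraMap A B) h) s.2.1).toAlgebra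
  have := isLocalization_away_map f h s.2.2
  have h1 : IsOpenImmersion (Spec.map (CommRingCat.ofHom
      (HomogeneousLocalization.Away.map (reesMap (algebraMap A B) h) s.2.1))) :=
    IsOpenImmersion.of_isLocalization (awayStr I s.2.1 f)
  have := hp.flip.isoPullback_hom_snd
  change IsOpenImmersion (pullback.snd (projReesMap (algebraMap A B) h)
    (Proj.awayι (reesGrading I) s.2.1 s.2.2 s.1.2))
  rw [← hp.flip.isoPullback_inv_snd]
  infer_instance

lemma isPullback_projReesMap (f : A) [Algebra A B] [IsLocalization.Away f B] {I : Ideal A}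
    {J : Ideal B} (h : I.map (algebraMap A B) = J) :
    IsPullback (projReesToSpec J) (projReesMap (algebraMap A B) h)
      (Spec.map (CommRingCat.ofHom (algebraMap A B))) (projReesToSpec I) := by
  have := isOpenImmersion_projReesMap f h
  have : IsOpenImmersion (Spec.map (CommRingCat.ofHom (algebraMap A B))) :=
    IsOpenImmersion.of_isLocalization f
  refine IsOpenImmersion.isPullback _ _ _ _ (projReesMap_toSpec _ h) ?_
  ext y
  constructor
  · rintro ⟨q, hq⟩
    have key {i : ℕ} (hi : 0 < i) {s : reesAlgebra I} (hs : s ∈ reesGrading I i)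
        (z : Spec (.of (HomogeneousLocalization.Away (reesGrading I) s)))
        (hz : projReesToSpec I (Proj.awayι (reesGrading I) s hs hi z) ∈
          Set.range (Spec.map (CommRingCat.ofHom (algebraMap A B)))) :
        Proj.awayι (reesGrading I) s hs hi z ∈ (projReesMap (algebraMap A B) h).opensRange := by
      rw [← Scheme.Hom.comp_apply, awayι_projReesToSpec I hs hi] at hz
      have hz' : PrimeSpectrum.comap (awayStr I s) z ∈
        Set.range (PrimeSpectrum.comap (algebraMap A B)) := hz
      rw [PrimeSpectrum.localization_away_comap_range B f] at hz'
      let := (HomogeneousLocalization.Away.map (reesMap (algebraMap A B) h) s).toAlgebra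
      have := isLocalization_away_map f h hs
      obtain ⟨w, hw'⟩ : ∃ w : Spec (.of (HomogeneousLocalization.Away (reesGrading J)
          (reesMap (algebraMap A B) h s))), Spec.map (CommRingCat.ofHom
          (HomogeneousLocalization.Away.map (reesMap (algebraMap A B) h) s)) w = z :=
        (Set.ext_iff.1 (PrimeSpectrum.localization_away_comap_range
          (HomogeneousLocalization.Away (reesGrading J) (reesMap (algebraMap A B) h s))
          (awayStr I s f)) z).2 hz'
      rw [← hw', ← Scheme.Hom.comp_apply, (isPullback_awayι (algebraMap A B) h hs hi).w,
        Scheme.Hom.comp_apply]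
      exact ⟨_, rfl⟩
    obtain ⟨t, z, rfl⟩ := (Proj.affineOpenCover (reesGrading I)).openCover.exists_eq y
    exact key t.1.2 t.2.2 z ⟨q, hq⟩
  · rintro ⟨w, rfl⟩
    refine ⟨projReesToSpec J w, ?_⟩
    rw [← Scheme.Hom.comp_apply, ← Scheme.Hom.comp_apply, projReesMap_toSpec]

lemma projReesMap_id (φ : A →+* A) (hφ : φ = RingHom.id A) (h : I.map φ = I) :
    projReesMap φ h = 𝟙 _ := by
  subst hφ
  have : reesMap (RingHom.id A) h = GradedRingHom.id (reesGrading I) := by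
    refine GradedRingHom.ext fun x => Subtype.ext ?_
    rw [coe_reesMap, Polynomial.map_id]; rfl
  rw [← Proj.map_id, projReesMap]
  congr 1

lemma projReesMap_comp {C : Type u} [CommRing C] (ψ : B →+* C) (χ : A →+* C) (hχ : χ = ψ.comp φ)
    {I : Ideal A} {J : Ideal B} {K : Ideal C} (h : I.map φ = J) (h' : J.map ψ = K)
    (h'' : I.map χ = K) :
    projReesMap χ h'' = projReesMap ψ h' ≫ projReesMap φ h := by
  subst hχ
  have : reesMap (ψ.comp φ) h'' = (reesMap ψ h').comp (reesMap φ h) := by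
    refine GradedRingHom.ext fun x => Subtype.ext ?_
    rw [coe_reesMap, ← Polynomial.map_map]; rfl
  rw [projReesMap, projReesMap, projReesMap, ← Proj.map_comp]
  congr 1

end Rees

namespace AlgebraicGeometry.Scheme.IdealSheafData

variable {X : Scheme.{u}} (I : X.IdealSheafData)

open Scheme.AffineZariskiSite

/-- The restriction `Γ(X, V) → Γ(X, U)`. -/
abbrev resHom {U V : X.AffineZariskiSite} (f : U ⟶ V) : Γ(X, V.1) →+* Γ(X, U.1) :=
  (X.presheaf.map (homOfLE (toOpens_mono f.le)).op).hom

/-- The schemes `Proj (⨁ₙ I(U)ⁿ tⁿ)`, functorially in the affine open subset `U` of `X`. -/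
def blowupFunctor : X.AffineZariskiSite ⥤ Scheme.{u} where
  obj U := Proj (reesGrading (I.ideal ⟨U.1, U.2⟩))
  map {U V} f := projReesMap (resHom f)
    (I.map_ideal (U := ⟨U.1, U.2⟩) (V := ⟨V.1, V.2⟩) (toOpens_mono f.le))
  map_id U := by
    apply projReesMap_id
    ext x
    simp [resHom]
  map_comp f g := by
    apply projReesMap_comp
    rw [← CommRingCat.hom_comp, ← X.presheaf.map_comp]
    rfl

/-- The structure morphisms `Proj (⨁ₙ I(U)ⁿ tⁿ) ⟶ U`. -/
def blowupNatTrans : blowupFunctor I ⟶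
    (Scheme.AffineZariskiSite.directedCover X).functorOfLocallyDirected where
  app U := projReesToSpec (I.ideal ⟨U.1, U.2⟩) ≫ U.2.isoSpec.inv
  naturality U V f := by
    have h1 := projReesMap_toSpec (resHom f)
      (I.map_ideal (U := ⟨U.1, U.2⟩) (V := ⟨V.1, V.2⟩) (toOpens_mono f.le))
    exact ((CommSq.mk h1).vert_comp (CommSq.mk ((restrictIsoSpec X).inv.naturality f))).w

/-- The gluing datum given by the schemes `Proj (⨁ₙ I(U)ⁿ tⁿ) ⟶ U`, for `U ⊆ X` affine open. -/
def blowupGluingData : (Scheme.AffineZariskiSite.directedCover X).RelativeGluingData where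
  functor := blowupFunctor I
  natTrans := blowupNatTrans I
  equifibered := by
    intro U V g
    obtain ⟨f, hf⟩ := g.le
    let := (resHom g).toAlgebra
    have : IsLocalization.Away f Γ(X, U.1) := by
      obtain ⟨U, hU⟩ := U
      obtain rfl : X.basicOpen f = U := hf
      exact V.2.isLocalization_basicOpen f
    have h1 := isPullback_projReesMap f (I.map_ideal (U := ⟨U.1, U.2⟩) (V := ⟨V.1, V.2⟩)
      (toOpens_mono g.le))
    exact h1.flip.paste_vert (NatTrans.Equifibered.of_isIso (restrictIsoSpec X).inv g)

/-- The blow-up of `X` along the closed subscheme `Z` defined by `I`: the relative `Proj` over `X`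
of the Rees algebra `⨁ₙ Iⁿ`, glued from the schemes `Proj (⨁ₙ I(U)ⁿ tⁿ)`, `U ⊆ X` affine open. -/
def blowup : Scheme.{u} := I.blowupGluingData.glued

/-- The blow-up morphism. -/
def blowupπ : I.blowup ⟶ X := I.blowupGluingData.toBase

/-- The normal cone `Spec (⨁ₙ Iⁿ / Iⁿ⁺¹)` of the closed subscheme defined by `I` is flat over `ℤ`:
over every affine open `U` of `X`, the ring `⨁ₙ I(U)ⁿ / I(U)ⁿ⁺¹` is `ℤ`-flat. -/
def HasZFlatNormalCone : Prop :=
  ∀ U : X.affineOpens, Module.Flat ℤ (DirectSum ℕ fun n =>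
    ↥(I.ideal U ^ n) ⧸ (I.ideal U ^ (n + 1)).submoduleOf (I.ideal U ^ n))

end AlgebraicGeometry.Scheme.IdealSheafData

/-- `ψ : X ⟶ X` lifts the `p`-power Frobenius: it agrees with the absolute Frobenius on
`X × Spec 𝔽_p`. The maps `Spec R ⟶ X × Spec 𝔽_p` are the maps `Spec R ⟶ X` where `p = 0` in `R`. -/
def IsFrobeniusLift {X : Scheme.{u}} (p : ℕ) [Fact p.Prime] (ψ : X ⟶ X) : Prop :=
  ∀ (R : Type u) [CommRing R] [CharP R p] (x : Spec (.of R) ⟶ X),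
    x ≫ ψ = Spec.map (CommRingCat.ofHom (frobenius R p)) ≫ x

/-- The structure of a `ℤ`-flat `Λ`-scheme on `X`: the scheme `X` is flat over `Spec ℤ`, with
a family of commuting endomorphisms `ψ p`, one for each prime `p`, lifting the Frobenius maps. -/
structure FlatLambdaStructure (X : Scheme.{u}) where
  /-- `X` is flat over `Spec ℤ`. -/
  flat : Flat (specULiftZIsTerminal.from X)
  /-- The Frobenius lifts. -/
  ψ (p : ℕ) [Fact p.Prime] : X ⟶ X
  comm (p q : ℕ) [Fact p.Prime] [Fact q.Prime] : ψ p ≫ ψ q = ψ q ≫ ψ p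
  isFrobeniusLift (p : ℕ) [Fact p.Prime] : IsFrobeniusLift p (ψ p)

namespace FlatLambdaStructure

variable {X Y : Scheme.{u}}

/-- A morphism of schemes is `Λ`-equivariant if it commutes with the Frobenius lifts. -/
def IsEquivariant (M : FlatLambdaStructure Y) (L : FlatLambdaStructure X) (f : Y ⟶ X) : Prop :=
  ∀ (p : ℕ) [Fact p.Prime], M.ψ p ≫ f = f ≫ L.ψ p

variable (L : FlatLambdaStructure X)

/-- `V` is an open `Λ`-subscheme: the Frobenius lifts of `X` restrict to `V`. Equivalently, `V` has
a (necessarily unique) `Λ`-structure for which the open immersion into `X` is `Λ`-equivariant. -/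
def IsStable (V : X.Opens) : Prop :=
  ∀ (p : ℕ) [Fact p.Prime], V ≤ L.ψ p ⁻¹ᵁ V

/-- The Frobenius lift `Γ(X, V) → Γ(X, V)` of an open `Λ`-subscheme `V`. -/
def frob {V : X.Opens} (hV : L.IsStable V) (p : ℕ) [Fact p.Prime] : Γ(X, V) →+* Γ(X, V) :=
  ((L.ψ p).appLE V V (hV p)).hom

/-- The affine opens `U i` form an affine `Λ`-cover of `X`: they cover `X`, they are open
`Λ`-subschemes, and each intersection `U i ∩ U j` is covered by open `Λ`-subschemes which are
distinguished opens of both `U i` and `U j`. -/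
structure IsAffineCover {ι : Type*} (U : ι → X.affineOpens) : Prop where
  iSup_eq_top : ⨆ i, (U i).1 = ⊤
  isStable (i : ι) : L.IsStable (U i).1
  exists_basicOpen (i j : ι) (x : X) (hi : x ∈ (U i).1) (hj : x ∈ (U j).1) :
    ∃ (f : Γ(X, (U i).1)) (g : Γ(X, (U j).1)), x ∈ X.basicOpen f ∧
      X.basicOpen f = X.basicOpen g ∧ L.IsStable (X.basicOpen f)

variable {L}

/-- The ideal sheaf `I` is locally toric for the affine `Λ`-cover `U`: each ideal `I (U i)` is
generated by finitely many elements `x` which are toric, i.e. `ψ p x = x ^ p` for all `p`. -/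
def IsAffineCover.IsLocallyToric {ι : Type*} {U : ι → X.affineOpens} (hU : L.IsAffineCover U)
    (I : X.IdealSheafData) : Prop :=
  ∀ i, ∃ s : Finset Γ(X, (U i).1), Ideal.span (s : Set Γ(X, (U i).1)) = I.ideal (U i) ∧
    ∀ x ∈ s, ∀ (p : ℕ) [Fact p.Prime], L.frob (hU.isStable i) p x = x ^ p

end FlatLambdaStructure

end

/-! The blow-up is covered by the charts `Spec A[It]_(xt)`, where `Spec A` is an affine open
`Λ`-subscheme and `x` is one of the toric generators of `I`. In such a chart `x` is a nonzerodivisor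
and generates the extension of `I`. The chart is universal for this: a map `A → C` extends to it as
soon as `x` becomes a nonzerodivisor generating `I C` (`ReesChart.exists_hom_extending`).

A Frobenius lift `φ` sends each toric generator `y` to `y ^ p = x ^ p * (y / x) ^ p`, so after `φ`
the ideal extends to the one generated by the nonzerodivisor `x ^ p`, and `φ` extends to the chart
(`ReesChart.exists_lift`). The extension sends `y / x` to `(y / x) ^ p`. Since these fractions
generate the chart over `A`, it is again a Frobenius lift. Extensions for different primes commute
by uniqueness.

The extensions glue because a lift of `ψ p ∘ π` to the blow-up is unique on anything flat over a
chart (`blowup_hom_ext`). Two lifts agree where `x` is invertible, since the ideal is trivial there,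
and this locus is scheme-theoretically dense; as `π` is separated, they agree everywhere.

For flatness, a relation in a chart can be tested in `A` after multiplying by a power of `x`, so the
charts inherit torsion-freeness from `A`.

The charts also form the affine `Λ`-cover. If `f` and `g` cut out a common stable distinguished open
of two members of the given cover, the part over it of the intersection of two charts is
distinguished in both: one localizes at `f`, then at a ratio of generators. -/

noncomputable section

/-! ### Fractions `a / xⁿ` in a chart of the blow-up algebra. -/

open Polynomial HomogeneousLocalization

variable {A : Type u} [CommRing A] {I : Ideal A}

/-- The element `x t` of the Rees algebra, for `x ∈ I`. -/
def ReesChart.var {x : A} (hx : x ∈ I) : reesAlgebra I :=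
  ⟨monomial 1 x, reesAlgebra.monomial_mem.2 (by simpa using hx)⟩

lemma ReesChart.var_mem {x : A} (hx : x ∈ I) : ReesChart.var hx ∈ reesGrading I 1 := ⟨x, rfl⟩

lemma ReesChart.coe_var_pow {x : A} (hx : x ∈ I) (n : ℕ) :
    (ReesChart.var hx ^ n).1 = monomial n (x ^ n) := by
  change (monomial 1 x) ^ n = _
  rw [monomial_pow, one_mul]

/-- The coordinate ring `A[It]_(xt)` of the chart of the blow-up given by `x ∈ I`. -/
def ReesChart {x : A} (hx : x ∈ I) : Type u :=
  HomogeneousLocalization.Away (reesGrading I) (ReesChart.var hx)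

namespace ReesChart

instance {x : A} (hx : x ∈ I) : CommRing (ReesChart hx) :=
  inferInstanceAs (CommRing (HomogeneousLocalization.Away (reesGrading I) (var hx)))

/-- The structure map of the chart. -/
def str {x : A} (hx : x ∈ I) : A →+* ReesChart hx := awayStr I (var hx)

/-- The inclusion of the chart into the localization of the Rees algebra. -/
def toLoc {x : A} (hx : x ∈ I) : ReesChart hx →+* Localization.Away (var hx) where
  toFun := HomogeneousLocalization.val (𝒜 := reesGrading I) (x := .powers (var hx))
  map_one' := val_one
  map_mul' := val_mul
  map_zero' := val_zero
  map_add' := val_add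

lemma toLoc_injective {x : A} (hx : x ∈ I) : Function.Injective (toLoc hx) :=
  val_injective _

lemma toLoc_str {x : A} (hx : x ∈ I) (a : A) :
    toLoc hx (str hx a) = Localization.mk (algebraMap A (reesAlgebra I) a) 1 := rfl

/-- The element `a / xⁿ` of the chart, for `a ∈ Iⁿ`. -/
def mk {x : A} (hx : x ∈ I) (n : ℕ) {a : A} (ha : a ∈ I ^ n) : ReesChart hx :=
  Away.mk (reesGrading I) (var_mem hx) n ⟨monomial n a, reesAlgebra.monomial_mem.2 ha⟩
    ⟨a, by simp⟩

variable {x : A} (hx : x ∈ I)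

lemma toLoc_mk {n : ℕ} {a : A} (ha : a ∈ I ^ n) : toLoc hx (mk hx n ha) =
    Localization.mk ⟨monomial n a, reesAlgebra.monomial_mem.2 ha⟩
      ⟨var hx ^ n, Submonoid.pow_mem _ (Submonoid.mem_powers _) n⟩ := rfl

lemma mk_surjective (b : ReesChart hx) : ∃ (n : ℕ) (a : A) (ha : a ∈ I ^ n), mk hx n ha = b := by
  obtain ⟨n, f, hf, rfl⟩ := Away.mk_surjective _ (var_mem hx) b
  have hf' := (mem_reesGrading I).1 hf
  simp only [smul_eq_mul, mul_one] at hf'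
  refine ⟨n, f.1.coeff n, f.2 n, ?_⟩
  apply toLoc_injective
  rw [toLoc_mk]
  refine Eq.trans ?_ (Away.val_mk (reesGrading I) n (var_mem hx) f hf).symm
  congr 1
  exact Subtype.ext hf'

lemma str_mul_mk (b : A) {n : ℕ} {a : A} (ha : a ∈ I ^ n) :
    str hx b * mk hx n ha = mk hx n (Ideal.mul_mem_left _ b ha) := by
  apply toLoc_injective
  rw [map_mul, toLoc_str, toLoc_mk, toLoc_mk, Localization.mk_mul]
  congr 1
  · refine Subtype.ext ?_
    change C b * monomial n a = monomial n (b * a)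
    rw [C_mul_monomial]
  · simp

lemma mk_zero {a : A} (ha : a ∈ I ^ 0) : mk hx 0 ha = str hx a := by
  apply toLoc_injective
  rw [toLoc_mk, toLoc_str]
  congr 1

/-- Inverting `x t` kills what a power of `x t` annihilates, and on monomials this is a condition in
`A`. It is the zero test behind both regularity of `x` and torsion-freeness. -/
lemma mk_eq_zero {n : ℕ} {a : A} (ha : a ∈ I ^ n) :
    mk hx n ha = 0 ↔ ∃ m, x ^ m * a = 0 := by
  rw [← (toLoc_injective hx).eq_iff, toLoc_mk, map_zero, Localization.mk_eq_mk',
    IsLocalization.mk'_eq_zero_iff]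
  have key (m : ℕ) : var hx ^ m * ⟨monomial n a, reesAlgebra.monomial_mem.2 ha⟩ = 0 ↔
      x ^ m * a = 0 := by
    rw [Subtype.ext_iff]
    change (var hx ^ m).1 * monomial n a = 0 ↔ _
    rw [coe_var_pow, monomial_mul_monomial, monomial_eq_zero_iff]
  constructor
  · rintro ⟨⟨_, m, rfl⟩, hm⟩
    exact ⟨m, (key m).1 hm⟩
  · rintro ⟨m, hm⟩
    exact ⟨⟨_, m, rfl⟩, (key m).2 hm⟩

lemma mk_mul_mk {n m : ℕ} {a b : A} (ha : a ∈ I ^ n) (hb : b ∈ I ^ m) :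
    mk hx n ha * mk hx m hb = mk hx (n + m) (pow_add I n m ▸ Ideal.mul_mem_mul ha hb) := by
  apply toLoc_injective
  rw [map_mul, toLoc_mk, toLoc_mk, toLoc_mk, Localization.mk_mul]
  congr 1
  · refine Subtype.ext ?_
    change monomial n a * monomial m b = monomial (n + m) (a * b)
    rw [monomial_mul_monomial]
  · exact Subtype.ext (pow_add _ n m).symm

lemma mk_add {n : ℕ} {a b : A} (ha : a ∈ I ^ n) (hb : b ∈ I ^ n) :
    mk hx n (add_mem ha hb) = mk hx n ha + mk hx n hb := by
  apply toLoc_injective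
  rw [map_add, toLoc_mk, toLoc_mk, toLoc_mk, Localization.add_mk_self]
  congr 1
  refine Subtype.ext ?_
  change monomial n (a + b) = monomial n a + monomial n b
  rw [map_add]

lemma mk_pow_self (n : ℕ) : mk hx n (Ideal.pow_mem_pow hx n) = 1 := by
  apply toLoc_injective
  rw [toLoc_mk, map_one]
  have : (⟨monomial n (x ^ n), reesAlgebra.monomial_mem.2 (Ideal.pow_mem_pow hx n)⟩ :
      reesAlgebra I) = var hx ^ n := Subtype.ext (coe_var_pow hx n).symm
  rw [this]
  exact Localization.mk_self ⟨var hx ^ n, Submonoid.pow_mem _ (Submonoid.mem_powers _) n⟩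

/-- With `n = 1` this shows that `x` generates the extension of `I` to the chart. -/
lemma str_pow_mul_mk {n : ℕ} {a : A} (ha : a ∈ I ^ n) :
    str hx x ^ n * mk hx n ha = str hx a := by
  rw [← map_pow, str_mul_mk]
  have : mk hx n (Ideal.mul_mem_left (I ^ n) (x ^ n) ha) =
      mk hx n (Ideal.mul_mem_left (I ^ n) a (Ideal.pow_mem_pow hx n)) := by
    congr 1
    exact mul_comm _ _
  rw [this, ← str_mul_mk hx a (Ideal.pow_mem_pow hx n), mk_pow_self, mul_one]

/-- Even if `x` is a zero divisor in `A`, its torsion has already been killed by inverting `x t`. -/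
lemma str_mem_nonZeroDivisors : str hx x ∈ nonZeroDivisors (ReesChart hx) := by
  rw [mem_nonZeroDivisors_iff_left]
  intro b hb
  obtain ⟨n, a, ha, rfl⟩ := mk_surjective hx b
  rw [str_mul_mk, mk_eq_zero] at hb
  obtain ⟨m, hm⟩ := hb
  rw [mk_eq_zero]
  exact ⟨m + 1, by rw [pow_succ, mul_assoc, hm]⟩

/-! ### Maps out of a chart: uniqueness and existence. -/

/-- Ring homomorphisms from the chart into a ring in which `x` is a nonzerodivisor are determined
by their restriction to `A`. -/
lemma hom_ext_of_mem_nonZeroDivisors {C : Type*} [CommRing C] {F G : ReesChart hx →+* C}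
    (h : F.comp (str hx) = G.comp (str hx)) (hF : F (str hx x) ∈ nonZeroDivisors C) : F = G := by
  have h' (a : A) : F (str hx a) = G (str hx a) := DFunLike.congr_fun h a
  ext b
  obtain ⟨n, a, ha, rfl⟩ := mk_surjective hx b
  apply (mul_cancel_left_mem_nonZeroDivisors (pow_mem hF n)).1
  rw [← map_pow, ← map_mul, str_pow_mul_mk, h' a, ← str_pow_mul_mk hx ha, map_mul, map_pow, map_pow,
    h']

/-- Ring homomorphisms from the chart are determined by their restriction to `A` and their values
on the fractions `y / x`, where `y` runs through a set of generators of `I`. -/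
lemma hom_ext_of_span {C : Type*} [CommRing C] {F G : ReesChart hx →+* C}
    (h : F.comp (str hx) = G.comp (str hx)) {s : Set A} (hs : Ideal.span s = I)
    (hFG : ∀ (y : A) (hy : y ∈ I ^ 1), y ∈ s → F (mk hx 1 hy) = G (mk hx 1 hy)) : F = G := by
  have h' (a : A) : F (str hx a) = G (str hx a) := DFunLike.congr_fun h a
  -- The image of `x` in `C` may be zero here, so powers of `x` cannot be cancelled. Instead the
  -- fractions are built up from degree one by sums and products.
  have one (y : A) (hy : y ∈ I ^ 1) : F (mk hx 1 hy) = G (mk hx 1 hy) := by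
    have hy' : y ∈ Ideal.span s := by rw [hs]; simpa using hy
    induction hy' using Submodule.span_induction with
    | mem y hys => exact hFG y hy hys
    | zero =>
      have : mk hx 1 hy = 0 := (mk_eq_zero hx hy).2 ⟨0, by simp⟩
      rw [this, map_zero, map_zero]
    | add y z hy' hz' ihy ihz =>
      rw [← Ideal.span, hs, ← pow_one I] at hy' hz'
      rw [mk_add hx hy' hz', map_add, map_add, ihy hy', ihz hz']
    | smul c y hy' ihy =>
      rw [← Ideal.span, hs, ← pow_one I] at hy'
      have : mk hx 1 hy = str hx c * mk hx 1 hy' := (str_mul_mk hx c hy').symm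
      rw [this, map_mul, map_mul, ihy hy', h']
  have all (n : ℕ) : ∀ (a : A) (ha : a ∈ I ^ n), F (mk hx n ha) = G (mk hx n ha) := by
    induction n with
    | zero => intro a ha; rw [mk_zero, h']
    | succ n ih =>
      intro a ha
      have ha' : a ∈ I ^ n * I ^ 1 := by rwa [← pow_add]
      induction ha' using Submodule.mul_induction_on' with
      | mem_mul_mem b hb c hc =>
        rw [← mk_mul_mk hx hb hc, map_mul, map_mul, ih, one]
      | add b hb c hc ihb ihc =>
        rw [← pow_add] at hb hc
        rw [mk_add hx hb hc, map_add, map_add, ihb, ihc]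
  ext b
  obtain ⟨n, a, ha, rfl⟩ := mk_surjective hx b
  exact all n a ha

/-- A ring homomorphism `A → C` extends to the chart given by `x` if `x` becomes a nonzerodivisor
generating `I C`. -/
lemma exists_hom_extending {C : Type*} [CommRing C] (g : A →+* C)
    (hg : g x ∈ nonZeroDivisors C) (hI : I.map g ≤ Ideal.span {g x}) :
    ∃ G : ReesChart hx →+* C, G.comp (str hx) = g := by
  let L := Localization.Away (g x)
  have hinj : Function.Injective (algebraMap C L) :=
    IsLocalization.injective L (Submonoid.powers_le.2 hg)
  -- Sending `t` to `1 / g x` makes `x t` go to `1`, so the map passes to the localization.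
  let e : Polynomial A →+* L :=
    eval₂RingHom ((algebraMap C L).comp g) (IsLocalization.Away.invSelf (g x))
  let h : reesAlgebra I →+* L := e.comp (reesAlgebra I).val.toRingHom
  have h1 : h (var hx) = 1 := by
    change e (monomial 1 x) = 1
    simp only [e, coe_eval₂RingHom, eval₂_monomial, pow_one, RingHom.comp_apply]
    exact IsLocalization.Away.mul_invSelf (g x)
  let k : ReesChart hx →+* L :=
    (Localization.awayLift h (var hx) (by rw [h1]; exact isUnit_one)).comp
    (toLoc hx)
  have hk (a : A) : k (str hx a) = algebraMap C L (g a) := by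
    change Localization.awayLift h (var hx) (h1 ▸ isUnit_one) (toLoc hx (str hx a)) = _
    rw [toLoc_str, Localization.mk_one_eq_algebraMap]
    refine (IsLocalization.Away.lift_eq (var hx) _ _).trans ?_
    change e (Polynomial.C a) = _
    simp [e]
  have hpow (n : ℕ) {a : A} (ha : a ∈ I ^ n) : g a ∈ Ideal.span {g x ^ n} := by
    rw [← Ideal.span_singleton_pow]
    exact Ideal.pow_right_mono hI n (Ideal.map_pow g I n ▸ Ideal.mem_map_of_mem g ha)
  -- The image of `a / xⁿ` is `g a / (g x)ⁿ`. Since `g x ^ n` divides `g a`, it lies in `C`, which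
  -- embeds in `L` by regularity of `g x`.
  have hrange (b : ReesChart hx) : k b ∈ (algebraMap C L).range := by
    obtain ⟨n, a, ha, rfl⟩ := mk_surjective hx b
    obtain ⟨c, hc⟩ := Ideal.mem_span_singleton'.1 (hpow n ha)
    refine ⟨c, ?_⟩
    have hu : IsUnit (algebraMap C L (g x) ^ n) :=
      (IsLocalization.Away.algebraMap_isUnit (g x)).pow n
    apply hu.mul_left_cancel
    rw [← map_pow, ← map_mul, mul_comm, hc, map_pow, ← hk x, ← map_pow, ← map_mul, str_pow_mul_mk,
      hk]
  let E : C ≃+* (algebraMap C L).range :=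
    RingEquiv.ofBijective (algebraMap C L).rangeRestrict
      ⟨fun a b hab => hinj (congrArg Subtype.val hab), RingHom.rangeRestrict_surjective _⟩
  refine ⟨E.symm.toRingHom.comp (k.codRestrict _ hrange), ?_⟩
  ext a
  apply E.injective
  refine (E.apply_symm_apply _).trans (Subtype.ext (hk a))

/-- If `n • (a / xᵐ) = 0`, then `n • (xᵏ a) = 0` in `A` for some `k`, so `xᵏ a = 0`. This is the
source of flatness of the blow-up. -/
lemma isTorsionFree [Module.IsTorsionFree ℤ A] : Module.IsTorsionFree ℤ (ReesChart hx) := by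
  refine Module.isTorsionFree_iff_smul_eq_zero.2 fun n b hb => or_iff_not_imp_left.2 fun hn => ?_
  obtain ⟨m, a, ha, rfl⟩ := mk_surjective hx b
  rw [mk_eq_zero]
  have h : n • mk hx m ha = mk hx m (Ideal.mul_mem_left _ (n : A) ha) := by
    rw [← str_mul_mk, map_intCast, zsmul_eq_mul]
  rw [h, mk_eq_zero] at hb
  obtain ⟨k, hk⟩ := hb
  refine ⟨k, ?_⟩
  rw [mul_left_comm, ← zsmul_eq_mul] at hk
  exact (smul_eq_zero.1 hk).resolve_left hn

/-! ### Extending Frobenius lifts to a chart. -/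

/-- If `φ x = xᵈ` for the generators `x` of `I`, then `φ` extends to each chart. -/
lemma exists_lift {s : Set A} (hs : Ideal.span s = I) (φ : A →+* A) {d : ℕ}
    (hφ : ∀ y ∈ s, φ y = y ^ d) (hxs : x ∈ s) :
    ∃ σ : ReesChart hx →+* ReesChart hx, σ.comp (str hx) = (str hx).comp φ := by
  refine exists_hom_extending hx _ ?_ ?_
  · rw [RingHom.comp_apply, hφ x hxs, map_pow]
    exact pow_mem (str_mem_nonZeroDivisors hx) d
  · have hI : I.map ((str hx).comp φ) = Ideal.span ((str hx).comp φ '' s) := by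
      rw [← Ideal.map_span, hs]
    rw [hI, Ideal.span_le]
    rintro _ ⟨y, hy, rfl⟩
    have hyI : y ∈ I ^ 1 := by rw [pow_one, ← hs]; exact Ideal.subset_span hy
    -- In the chart `y = x * (y / x)`, hence `y ^ d` is `x ^ d` times `(y / x) ^ d`.
    rw [SetLike.mem_coe, Ideal.mem_span_singleton, RingHom.comp_apply, RingHom.comp_apply,
      hφ x hxs, hφ y hy, map_pow, map_pow, ← str_pow_mul_mk hx hyI, pow_one, mul_pow]
    exact dvd_mul_right _ _

/-- The extension of `φ` to the chart sends `y / x` to `(y / x)ᵈ`. -/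
lemma lift_mk_one {φ : A →+* A} {d : ℕ} {σ : ReesChart hx →+* ReesChart hx}
    (hσ : σ.comp (str hx) = (str hx).comp φ) (hφx : φ x = x ^ d)
    {y : A} (hy : y ∈ I ^ 1) (hφy : φ y = y ^ d) : σ (mk hx 1 hy) = mk hx 1 hy ^ d := by
  have h' (a : A) : σ (str hx a) = str hx (φ a) := DFunLike.congr_fun hσ a
  apply (mul_cancel_left_mem_nonZeroDivisors (pow_mem (str_mem_nonZeroDivisors hx) d)).1
  rw [← mul_pow, ← map_pow, ← hφx, ← h' x, ← map_mul]
  have := str_pow_mul_mk hx hy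
  rw [pow_one] at this
  rw [this, h', hφy, map_pow]

/-- Both composites extend the same map on `A`, which sends `x` to a power of `x`, a nonzerodivisor;
such an extension is unique. -/
lemma lift_comm {φ₁ φ₂ : A →+* A} {d e : ℕ} {σ₁ σ₂ : ReesChart hx →+* ReesChart hx}
    (h₁ : σ₁.comp (str hx) = (str hx).comp φ₁) (h₂ : σ₂.comp (str hx) = (str hx).comp φ₂)
    (hφ₁ : φ₁ x = x ^ d) (hφ₂ : φ₂ x = x ^ e) (h : φ₁.comp φ₂ = φ₂.comp φ₁) :
    σ₁.comp σ₂ = σ₂.comp σ₁ := by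
  have h₁' (a : A) : σ₁ (str hx a) = str hx (φ₁ a) := DFunLike.congr_fun h₁ a
  have h₂' (a : A) : σ₂ (str hx a) = str hx (φ₂ a) := DFunLike.congr_fun h₂ a
  refine hom_ext_of_mem_nonZeroDivisors hx ?_ ?_
  · ext a
    have := DFunLike.congr_fun h a
    simp only [RingHom.comp_apply, h₁', h₂'] at this ⊢
    rw [this]
  · rw [RingHom.comp_apply, h₂', h₁', hφ₂, map_pow, hφ₁, map_pow, map_pow]
    exact pow_mem (pow_mem (str_mem_nonZeroDivisors hx) _) _

/-- If `φ` induces the Frobenius on a map `A → R` to a ring of characteristic `p`, then so do its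
extensions to the charts. -/
lemma lift_frobenius {s : Set A} (hs : Ideal.span s = I) {φ : A →+* A} {p : ℕ} [Fact p.Prime]
    {σ : ReesChart hx →+* ReesChart hx} (hσ : σ.comp (str hx) = (str hx).comp φ)
    (hφ : ∀ y ∈ s, φ y = y ^ p) (hxs : x ∈ s) {R : Type*} [CommRing R] [CharP R p]
    (g : ReesChart hx →+* R)
    (hg : (g.comp (str hx)).comp φ = (frobenius R p).comp (g.comp (str hx))) :
    g.comp σ = (frobenius R p).comp g := by
  -- As `x` may vanish in `R`, the comparison is made on the fractions `y / x`, where `σ` is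
  -- literally the `p`-th power.
  refine hom_ext_of_span hx ?_ hs fun y hy hys => ?_
  · rw [RingHom.comp_assoc, hσ, ← RingHom.comp_assoc, hg, RingHom.comp_assoc]
  · rw [RingHom.comp_apply, lift_mk_one hx hσ (hφ x hxs) hy (hφ y hys), map_pow]
    rfl

/-- The Rees algebra is generated in degree one because `Iⁿ⁺¹ = I * Iⁿ`. Consequently the charts of
any generating set of `I` cover `Proj`. -/
lemma irrelevant_le_span {s : Set A} (hs : Ideal.span s = I) (hsI : ∀ x ∈ s, x ∈ I) :
    (HomogeneousIdeal.irrelevant (reesGrading I)).toIdeal ≤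
      Ideal.span (Set.range fun y : s => var (hsI y.1 y.2)) := by
  refine (HomogeneousIdeal.toIdeal_irrelevant_le (reesGrading I)).2 fun n hn f hf => ?_
  obtain ⟨n, rfl⟩ := Nat.exists_eq_succ_of_ne_zero hn.ne'
  change f ∈ reesGrading I (n + 1) at hf
  rw [mem_reesGrading] at hf
  have hc : f.1.coeff (n + 1) ∈ I * I ^ n := by rw [← pow_succ']; exact f.2 (n + 1)
  have one (b : A) (hb : b ∈ I) :
      var hb ∈ Ideal.span (Set.range fun y : s => var (hsI y.1 y.2)) := by
    have hb' : b ∈ Ideal.span s := by rwa [hs]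
    induction hb' using Submodule.span_induction with
    | mem y hys => exact Ideal.subset_span ⟨⟨y, hys⟩, rfl⟩
    | zero =>
      have : var hb = 0 := Subtype.ext (map_zero (monomial 1))
      rw [this]
      exact zero_mem _
    | add y z hy hz ihy ihz =>
      rw [← Ideal.span, hs] at hy hz
      have : var hb = var hy + var hz := Subtype.ext (map_add (monomial 1) y z)
      rw [this]
      exact add_mem (ihy hy) (ihz hz)
    | smul c y hy ihy =>
      rw [← Ideal.span, hs] at hy
      have : var hb = c • var hy := Subtype.ext (map_smul (monomial 1) c y)
      rw [this]
      exact Submodule.smul_of_tower_mem _ c (ihy hy)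
  have key (c : A) (hc : c ∈ I * I ^ n) : ∀ f : reesAlgebra I, f.1 = monomial (n + 1) c →
      f ∈ Ideal.span (Set.range fun y : s => var (hsI y.1 y.2)) := by
    induction hc using Submodule.mul_induction_on' with
    | mem_mul_mem b hb c hc =>
      intro f hf
      have : f = ⟨monomial n c, reesAlgebra.monomial_mem.2 hc⟩ * var hb := by
        refine Subtype.ext (hf.trans ?_)
        change _ = monomial n c * monomial 1 b
        rw [monomial_mul_monomial, mul_comm]
      rw [this]
      exact Ideal.mul_mem_left _ _ (one b hb)
    | add b hb c hc ihb ihc =>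
      intro f hf
      rw [← pow_succ'] at hb hc
      have : f = ⟨monomial (n + 1) b, reesAlgebra.monomial_mem.2 hb⟩ +
          ⟨monomial (n + 1) c, reesAlgebra.monomial_mem.2 hc⟩ :=
        Subtype.ext (hf.trans (map_add _ _ _))
      rw [this]
      exact add_mem (ihb _ rfl) (ihc _ rfl)
  exact key _ hc f hf.symm

end ReesChart

end

/-! ### Scheme-theoretic density and uniqueness of maps to the blow-up. -/

noncomputable section

namespace AlgebraicGeometry

open Limits

/-- Two morphisms over `Z` to a separated `Z`-scheme are equal if they agree after composition with
a scheme-theoretically dominant morphism. -/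
lemma ext_of_isSchemeTheoreticallyDominant_of_isSeparated {W X Y Z : Scheme.{u}} {f g : X ⟶ Y}
    (s : Y ⟶ Z) [IsSeparated s] (h : f ≫ s = g ≫ s)
    (ι : W ⟶ X) [IsSchemeTheoreticallyDominant ι] (hU : ι ≫ f = ι ≫ g) : f = g := by
  let X' : Over Z := Over.mk (f ≫ s)
  let Y' : Over Z := Over.mk s
  let U' : Over Z := Over.mk (ι ≫ f ≫ s)
  let f' : X' ⟶ Y' := Over.homMk f
  let g' : X' ⟶ Y' := Over.homMk g
  let ι' : U' ⟶ X' := Over.homMk ι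
  have : IsSeparated Y'.hom := ‹_›
  have hι : ι' ≫ f' = ι' ≫ g' := by ext1; exact hU
  -- By separatedness the equalizer is a closed subscheme. As `ι` factors through it, its ideal lies
  -- in the kernel of `ι`, which is zero.
  have hker : (equalizer.ι f' g').left.ker = ⊥ := by
    have h1 := (equalizer.lift ι' hι).left.le_ker_comp (equalizer.ι f' g').left
    rw [← Over.comp_left, equalizer.lift_ι] at h1
    exact le_bot_iff.1 (h1.trans ι.ker_eq_bot.le)
  have : IsIso (equalizer.ι f' g').left := IsClosedImmersion.isIso_iff_ker_eq_bot.2 hker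
  rw [← cancel_epi (equalizer.ι f' g').left]
  exact congr($(equalizer.condition f' g').left)

lemma isSchemeTheoreticallyDominant_specMap {R S : CommRingCat.{u}} (f : R ⟶ S)
    (hf : Function.Injective f) : IsSchemeTheoreticallyDominant (Spec.map f) := by
  rw [isSchemeTheoreticallyDominant_iff, Scheme.ker_of_isAffine]
  have h1 : Function.Injective (Spec.map f).appTop.hom := by
    have h2 : (Spec.map f).appTop = (Scheme.ΓSpecIso R).hom ≫ f ≫ (Scheme.ΓSpecIso S).inv := by
      rw [Scheme.ΓSpecIso_inv_naturality, Iso.hom_inv_id_assoc]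
    rw [h2]
    exact (((Scheme.ΓSpecIso S).symm.commRingCatIsoToRingEquiv.injective.comp hf).comp
      (Scheme.ΓSpecIso R).commRingCatIsoToRingEquiv.injective)
  rw [(RingHom.injective_iff_ker_eq_bot _).1 h1]
  exact Scheme.IdealSheafData.ext_of_isAffine (by simp)

/-- The localization at a nonzerodivisor defines a scheme-theoretically dense open subscheme. -/
lemma isSchemeTheoreticallyDominant_away {R : Type u} [CommRing R] {r : R}
    (hr : r ∈ nonZeroDivisors R) : IsSchemeTheoreticallyDominant
      (Spec.map (CommRingCat.ofHom (algebraMap R (Localization.Away r)))) :=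
  isSchemeTheoreticallyDominant_specMap _
    (IsLocalization.injective (Localization.Away r) (Submonoid.powers_le.2 hr))

/-- The chart of `Proj A[It]` given by `x ∈ I`. -/
def _root_.ReesChart.ι {A : Type u} [CommRing A] {I : Ideal A} {x : A} (hx : x ∈ I) :
    Spec (.of (ReesChart hx)) ⟶ Proj (reesGrading I) :=
  Proj.awayι (reesGrading I) (ReesChart.var hx) (ReesChart.var_mem hx) one_pos

instance {A : Type u} [CommRing A] {I : Ideal A} {x : A} (hx : x ∈ I) :
    IsOpenImmersion (ReesChart.ι hx) :=
  inferInstanceAs (IsOpenImmersion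
    (Proj.awayι (reesGrading I) (ReesChart.var hx) (ReesChart.var_mem hx) one_pos))

lemma _root_.ReesChart.opensRange_ι {A : Type u} [CommRing A] {I : Ideal A} {x : A} (hx : x ∈ I) :
    (ReesChart.ι hx).opensRange = Proj.basicOpen (reesGrading I) (ReesChart.var hx) :=
  Proj.opensRange_awayι _ _ _ _

lemma _root_.ReesChart.ι_projReesToSpec {A : Type u} [CommRing A] {I : Ideal A} {x : A}
    (hx : x ∈ I) :
    ReesChart.ι hx ≫ projReesToSpec I = Spec.map (CommRingCat.ofHom (ReesChart.str hx)) :=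
  awayι_projReesToSpec I (ReesChart.var_mem hx) one_pos

/-- If `I` is the unit ideal, then `Proj A[It] ⟶ Spec A` is a monomorphism. -/
lemma mono_projReesToSpec {A : Type u} [CommRing A] {I : Ideal A} (hI : I = ⊤) :
    Mono (projReesToSpec I) := by
  have h1 : (1 : A) ∈ I := hI ▸ trivial
  have hcov : Proj.basicOpen (reesGrading I) (ReesChart.var h1) = ⊤ := by
    have := Proj.iSup_basicOpen_eq_top (reesGrading I) _
      (ReesChart.irrelevant_le_span (I := I) (s := {1})
        (by rw [hI, Ideal.span_singleton_one]) (by rintro _ rfl; exact h1))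
    rw [← this]
    exact (ciSup_unique (ι := ({1} : Set A)) (s := fun y =>
      Proj.basicOpen (reesGrading I) (ReesChart.var (I := I) (x := y.1) _))).symm
  have : IsIso (ReesChart.ι h1) :=
    isIso_of_isOpenImmersion_of_opensRange_eq_top _ ((ReesChart.opensRange_ι h1).trans hcov)
  -- Surjectivity makes the structure morphism of the only chart a closed immersion, which is enough
  -- for a monomorphism.
  have hsurj : Function.Surjective (ReesChart.str h1) := by
    intro b
    obtain ⟨n, a, ha, rfl⟩ := ReesChart.mk_surjective h1 b
    refine ⟨a, ?_⟩
    rw [← ReesChart.str_pow_mul_mk h1 ha, map_one, one_pow, one_mul]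
  have : IsClosedImmersion (Spec.map (CommRingCat.ofHom (ReesChart.str h1))) :=
    IsClosedImmersion.spec_of_surjective _ hsurj
  rw [← IsIso.inv_hom_id_assoc (ReesChart.ι h1) (projReesToSpec I), ReesChart.ι_projReesToSpec]
  infer_instance

/-- The open immersion `Spec Γ(X, U) ⟶ X` for an affine open `U`. -/
def Scheme.specι {X : Scheme.{u}} (U : X.affineOpens) : Spec (.of Γ(X, U.1)) ⟶ X :=
  IsAffineOpen.fromSpec U.2

instance {X : Scheme.{u}} (U : X.affineOpens) : IsOpenImmersion (X.specι U) :=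
  IsAffineOpen.isOpenImmersion_fromSpec U.2

lemma Scheme.opensRange_specι {X : Scheme.{u}} (U : X.affineOpens) :
    (X.specι U).opensRange = U.1 :=
  IsAffineOpen.opensRange_fromSpec U.2

lemma Scheme.specMap_res_specι {X : Scheme.{u}} (U : X.affineOpens) (f : Γ(X, U.1)) :
    Spec.map (CommRingCat.ofHom (X.presheaf.map (homOfLE (X.basicOpen_le f)).op).hom) ≫ X.specι U =
      X.specι (X.affineBasicOpen f) :=
  IsAffineOpen.map_fromSpec (U := U.1) U.2 (X.affineBasicOpen f).2 (homOfLE (X.basicOpen_le f)).op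

namespace Scheme.Cover.RelativeGluingData

variable {S : Scheme.{u}} {𝒰 : S.OpenCover} [Category 𝒰.I₀] [𝒰.LocallyDirected]
  (d : RelativeGluingData 𝒰) [Small.{u} 𝒰.I₀] [Quiver.IsThin 𝒰.I₀]

/-- The inclusion of a piece of the glued scheme. -/
def ι (i : 𝒰.I₀) : d.functor.obj i ⟶ d.glued := colimit.ι d.functor i

instance (i : 𝒰.I₀) : IsOpenImmersion (d.ι i) :=
  d.cover.map_prop i

lemma ι_comp_toBase (i : 𝒰.I₀) : d.ι i ≫ d.toBase = d.natTrans.app i ≫ 𝒰.f i :=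
  d.ι_toBase i

lemma opensRange_ι (i : 𝒰.I₀) : (d.ι i).opensRange = d.toBase ⁻¹ᵁ (𝒰.f i).opensRange :=
  (d.toBase_preimage_eq_opensRange_ι i).symm

lemma map_ι {i j : 𝒰.I₀} (f : i ⟶ j) : d.functor.map f ≫ d.ι j = d.ι i :=
  colimit.w d.functor f

lemma isSeparated_toBase (h : ∀ i, IsSeparated (d.natTrans.app i)) : IsSeparated d.toBase := by
  refine IsZariskiLocalAtTarget.of_openCover (P := @IsSeparated) (𝒰 := 𝒰) fun i => ?_
  have hp := (d.isPullback_natTrans_ι_toBase i).flip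
  have := h i
  have h2 : IsSeparated (hp.isoPullback.inv ≫ d.natTrans.app i) := inferInstance
  rw [hp.isoPullback_inv_snd] at h2
  exact h2

end Scheme.Cover.RelativeGluingData

namespace Scheme.IdealSheafData

variable {X : Scheme.{u}} (I : X.IdealSheafData)

/-- The inclusion of the part of the blow-up over an affine open `U`. -/
def blowupι (U : X.affineOpens) : Proj (reesGrading (I.ideal U)) ⟶ I.blowup :=
  I.blowupGluingData.ι ⟨U.1, U.2⟩

instance (U : X.affineOpens) : IsOpenImmersion (I.blowupι U) :=
  I.blowupGluingData.cover.map_prop ⟨U.1, U.2⟩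

lemma blowupι_π (U : X.affineOpens) :
    I.blowupι U ≫ I.blowupπ = projReesToSpec (I.ideal U) ≫ X.specι U :=
  (I.blowupGluingData.ι_comp_toBase ⟨U.1, U.2⟩).trans (Category.assoc _ _ _)

lemma opensRange_blowupι (U : X.affineOpens) :
    (I.blowupι U).opensRange = I.blowupπ ⁻¹ᵁ U.1 := by
  refine (I.blowupGluingData.opensRange_ι ⟨U.1, U.2⟩).trans ?_
  change I.blowupπ ⁻¹ᵁ U.1.ι.opensRange = _
  rw [Scheme.Opens.opensRange_ι]

lemma isPullback_blowupι (U : X.affineOpens) :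
    IsPullback (projReesToSpec (I.ideal U)) (I.blowupι U) (X.specι U) I.blowupπ := by
  refine IsOpenImmersion.isPullback _ _ _ _ (I.blowupι_π U) ?_
  rw [opensRange_blowupι, opensRange_specι]

instance {A : Type u} [CommRing A] (J : Ideal A) : IsSeparated (projReesToSpec J) :=
  inferInstanceAs (IsSeparated (Proj.toSpecZero (reesGrading J) ≫ _))

instance : IsSeparated I.blowupπ :=
  I.blowupGluingData.isSeparated_toBase fun U =>
    inferInstanceAs (IsSeparated (projReesToSpec (I.ideal ⟨U.1, U.2⟩) ≫ U.2.isoSpec.inv))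

lemma projReesMap_blowupι (U : X.affineOpens) (f : Γ(X, U.1)) :
    projReesMap _ (I.map_ideal_basicOpen U f) ≫ I.blowupι U = I.blowupι (X.affineBasicOpen f) :=
  I.blowupGluingData.map_ι (homOfLE (Scheme.AffineZariskiSite.basicOpen_le ⟨U.1, U.2⟩ f))

/-- The chart of the blow-up given by a section `x` of the ideal over an affine open `U`. -/
def chartι {U : X.affineOpens} {x : Γ(X, U.1)} (hx : x ∈ I.ideal U) :
    Spec (.of (ReesChart hx)) ⟶ I.blowup :=
  ReesChart.ι hx ≫ I.blowupι U

instance {U : X.affineOpens} {x : Γ(X, U.1)} (hx : x ∈ I.ideal U) :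
    IsOpenImmersion (I.chartι hx) :=
  inferInstanceAs (IsOpenImmersion (ReesChart.ι hx ≫ I.blowupι U))

lemma chartι_π {U : X.affineOpens} {x : Γ(X, U.1)} (hx : x ∈ I.ideal U) :
    I.chartι hx ≫ I.blowupπ = Spec.map (CommRingCat.ofHom (ReesChart.str hx)) ≫ X.specι U := by
  rw [chartι, Category.assoc, blowupι_π, ← Category.assoc, ReesChart.ι_projReesToSpec]

/-- Morphisms to the blow-up over `X` are equal if their common composition with `π` factors
through an affine open on which the ideal is the unit ideal. -/
lemma hom_ext_of_ideal_eq_top (U : X.affineOpens) (hU : I.ideal U = ⊤) {T : Scheme.{u}}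
    {f g : T ⟶ I.blowup} (h : f ≫ I.blowupπ = g ≫ I.blowupπ) (k : T ⟶ Spec (.of Γ(X, U.1)))
    (hk : f ≫ I.blowupπ = k ≫ X.specι U) : f = g := by
  have := mono_projReesToSpec hU
  have hp := I.isPullback_blowupι U
  -- Both maps land over `U`, so they factor through the `Proj` over `U`, which is a monomorphism
  -- over `Spec Γ(X, U)`.
  rw [← hp.lift_snd k f hk.symm, ← hp.lift_snd k g (h ▸ hk.symm)]
  congr 1
  rw [← cancel_mono (projReesToSpec (I.ideal U)), hp.lift_fst, hp.lift_fst]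

/-- Uniqueness part of the universal property of blow-ups: two `X`-morphisms from a flat
`Spec C`-scheme to the blow-up are equal if some section of the ideal becomes a nonzerodivisor
in `C`. -/
lemma blowup_hom_ext {U : X.affineOpens} {x : Γ(X, U.1)} (hx : x ∈ I.ideal U) {C : Type u}
    [CommRing C] (e : Γ(X, U.1) →+* C) (he : e x ∈ nonZeroDivisors C) {T : Scheme.{u}}
    (j : T ⟶ Spec (.of C)) [Flat j] {f g : T ⟶ I.blowup} (h : f ≫ I.blowupπ = g ≫ I.blowupπ)
    (hf : f ≫ I.blowupπ = j ≫ Spec.map (CommRingCat.ofHom e) ≫ X.specι U) : f = g := by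
  let l := Spec.map (CommRingCat.ofHom (algebraMap C (Localization.Away (e x))))
  have : IsSchemeTheoreticallyDominant l := isSchemeTheoreticallyDominant_away he
  -- Flatness of `j` preserves density of the locus where `e x` is invertible. On its preimage in
  -- `T` the map to `X` lands in the basic open of `x`, where the ideal contains a unit.
  refine ext_of_isSchemeTheoreticallyDominant_of_isSeparated I.blowupπ h (pullback.fst j l) ?_
  let V : X.affineOpens := X.affineBasicOpen x
  let : Algebra Γ(X, U.1) Γ(X, V.1) :=
    (X.presheaf.map (homOfLE (X.basicOpen_le x)).op).hom.toAlgebra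
  have : IsLocalization.Away x Γ(X, V.1) := IsAffineOpen.isLocalization_basicOpen U.2 x
  have hV : I.ideal V = ⊤ := by
    rw [← I.map_ideal_basicOpen U x]
    exact Ideal.eq_top_of_isUnit_mem _ (Ideal.mem_map_of_mem _ hx)
      (IsLocalization.Away.algebraMap_isUnit (S := Γ(X, V.1)) x)
  let e' : Γ(X, V.1) →+* Localization.Away (e x) :=
    IsLocalization.Away.lift (g := (algebraMap C (Localization.Away (e x))).comp e) x
      (IsLocalization.Away.algebraMap_isUnit (e x))
  have he' : e'.comp (X.presheaf.map (homOfLE (X.basicOpen_le x)).op).hom =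
    (algebraMap C (Localization.Away (e x))).comp e := IsLocalization.Away.lift_comp x _
  refine I.hom_ext_of_ideal_eq_top V hV ?_ (pullback.snd j l ≫ Spec.map (CommRingCat.ofHom e')) ?_
  · rw [Category.assoc, Category.assoc, h]
  · rw [Category.assoc, hf, pullback.condition_assoc, Category.assoc]
    congr 1
    have h1 : CommRingCat.ofHom (X.presheaf.map (homOfLE (X.basicOpen_le x)).op).hom ≫
        CommRingCat.ofHom e' =
        CommRingCat.ofHom e ≫ CommRingCat.ofHom (algebraMap C (Localization.Away (e x))) :=
      CommRingCat.hom_ext he'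
    have h2 := congrArg Spec.map h1
    rw [Spec.map_comp, Spec.map_comp] at h2
    refine (Category.assoc _ _ _).symm.trans ((congrArg (· ≫ X.specι U) h2).symm.trans ?_)
    refine (Category.assoc _ _ _).trans ?_
    rw [X.specMap_res_specι U x]
    rfl

end Scheme.IdealSheafData

end AlgebraicGeometry

end

/-! ### Toric charts and gluing of the Frobenius lifts. -/

noncomputable section

open Limits

variable {X : Scheme.{u}}

lemma FlatLambdaStructure.specMap_frob_specι (L : FlatLambdaStructure X) {U : X.affineOpens}
    (hU : L.IsStable U.1) (p : ℕ) [Fact p.Prime] :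
    Spec.map (CommRingCat.ofHom (L.frob hU p)) ≫ X.specι U = X.specι U ≫ L.ψ p :=
  IsAffineOpen.SpecMap_appLE_fromSpec (L.ψ p) U.2 U.2 (hU p)

lemma FlatLambdaStructure.frob_comm (L : FlatLambdaStructure X) {U : X.affineOpens}
    (hU : L.IsStable U.1) (p q : ℕ) [Fact p.Prime] [Fact q.Prime] :
    (L.frob hU p).comp (L.frob hU q) = (L.frob hU q).comp (L.frob hU p) := by
  refine congrArg CommRingCat.Hom.hom (Spec.map_injective (R := .of Γ(X, U.1))
    (S := .of Γ(X, U.1)) (a₁ := CommRingCat.ofHom ((L.frob hU p).comp (L.frob hU q)))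
    (a₂ := CommRingCat.ofHom ((L.frob hU q).comp (L.frob hU p))) ?_)
  rw [← cancel_mono (X.specι U), CommRingCat.ofHom_comp, CommRingCat.ofHom_comp, Spec.map_comp,
    Spec.map_comp, Category.assoc, Category.assoc, L.specMap_frob_specι, L.specMap_frob_specι,
    ← Category.assoc, ← Category.assoc, L.specMap_frob_specι, L.specMap_frob_specι,
    Category.assoc, Category.assoc, L.comm]

/-- If `R` has characteristic `p`, then the Frobenius lift of an affine open `Λ`-subscheme `U`
becomes the Frobenius after composition with any map `Γ(X, U) → R`. -/
lemma FlatLambdaStructure.comp_frob (L : FlatLambdaStructure X) {U : X.affineOpens}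
    (hU : L.IsStable U.1) (p : ℕ) [Fact p.Prime] {R : Type u} [CommRing R] [CharP R p]
    (g : Γ(X, U.1) →+* R) : g.comp (L.frob hU p) = (frobenius R p).comp g := by
  refine congrArg CommRingCat.Hom.hom (Spec.map_injective (R := .of Γ(X, U.1))
    (S := .of R) (a₁ := CommRingCat.ofHom (g.comp (L.frob hU p)))
    (a₂ := CommRingCat.ofHom ((frobenius R p).comp g)) ?_)
  rw [← cancel_mono (X.specι U), CommRingCat.ofHom_comp, CommRingCat.ofHom_comp, Spec.map_comp,
    Spec.map_comp, Category.assoc, Category.assoc, L.specMap_frob_specι, ← Category.assoc]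
  exact L.isFrobeniusLift p R _

/-- A chart of the blow-up given by an element `x` of a set of toric generators of the ideal
on an affine open `Λ`-subscheme. -/
structure ToricChart (L : FlatLambdaStructure X) (I : X.IdealSheafData) where
  /-- The affine open `Λ`-subscheme. -/
  U : X.affineOpens
  isStable : L.IsStable U.1
  /-- The toric generators. -/
  s : Set Γ(X, U.1)
  span_eq : Ideal.span s = I.ideal U
  frob_eq (y : Γ(X, U.1)) (_ : y ∈ s) (p : ℕ) [Fact p.Prime] : L.frob isStable p y = y ^ p
  /-- The generator which defines the chart. -/
  x : Γ(X, U.1)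
  x_mem : x ∈ s

namespace ToricChart

variable {L : FlatLambdaStructure X} {I : X.IdealSheafData} (c : ToricChart L I)

lemma mem : c.x ∈ I.ideal c.U := c.span_eq ▸ Ideal.subset_span c.x_mem

/-- The open immersion of the chart into the blow-up. -/
def ι : Spec (.of (ReesChart c.mem)) ⟶ I.blowup := I.chartι c.mem

instance : IsOpenImmersion c.ι := inferInstanceAs (IsOpenImmersion (I.chartι c.mem))

lemma ι_π : c.ι ≫ I.blowupπ =
    Spec.map (CommRingCat.ofHom (ReesChart.str c.mem)) ≫ X.specι c.U :=
  I.chartι_π c.mem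

lemma ι_π_assoc {Z : Scheme.{u}} (k : X ⟶ Z) : c.ι ≫ I.blowupπ ≫ k =
    Spec.map (CommRingCat.ofHom (ReesChart.str c.mem)) ≫ X.specι c.U ≫ k := by
  rw [← Category.assoc, ι_π, Category.assoc]

/-- The Frobenius lift of the chart. -/
def σ (p : ℕ) [Fact p.Prime] : ReesChart c.mem →+* ReesChart c.mem :=
  (ReesChart.exists_lift c.mem c.span_eq (L.frob c.isStable p)
    (fun y hy => c.frob_eq y hy p) c.x_mem).choose

lemma σ_comp_str (p : ℕ) [Fact p.Prime] :
    (c.σ p).comp (ReesChart.str c.mem) = (ReesChart.str c.mem).comp (L.frob c.isStable p) :=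
  (ReesChart.exists_lift c.mem c.span_eq (L.frob c.isStable p)
    (fun y hy => c.frob_eq y hy p) c.x_mem).choose_spec

lemma σ_comm (p q : ℕ) [Fact p.Prime] [Fact q.Prime] :
    (c.σ p).comp (c.σ q) = (c.σ q).comp (c.σ p) :=
  ReesChart.lift_comm c.mem (c.σ_comp_str p) (c.σ_comp_str q) (c.frob_eq c.x c.x_mem p)
    (c.frob_eq c.x c.x_mem q) (L.frob_comm c.isStable p q)

/-- The morphism `ψ p` of the chart. -/
def ψ (p : ℕ) [Fact p.Prime] : Spec (.of (ReesChart c.mem)) ⟶ Spec (.of (ReesChart c.mem)) :=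
  Spec.map (CommRingCat.ofHom (c.σ p))

lemma ψ_comm (p q : ℕ) [Fact p.Prime] [Fact q.Prime] : c.ψ p ≫ c.ψ q = c.ψ q ≫ c.ψ p := by
  rw [ψ, ψ, ← Spec.map_comp, ← Spec.map_comp, ← CommRingCat.ofHom_comp, ← CommRingCat.ofHom_comp,
    σ_comm]

lemma ψ_ι_π (p : ℕ) [Fact p.Prime] : c.ψ p ≫ c.ι ≫ I.blowupπ = c.ι ≫ I.blowupπ ≫ L.ψ p := by
  rw [ι_π, ι_π_assoc, ← L.specMap_frob_specι c.isStable, ψ, ← Category.assoc, ← Category.assoc,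
    ← Spec.map_comp, ← Spec.map_comp, ← CommRingCat.ofHom_comp, ← CommRingCat.ofHom_comp,
    c.σ_comp_str]

/-- The map to `X` is twisted by `ψ p`, so uniqueness is applied to `str ∘ frob` instead of `str`;
it sends `x` to `x ^ p`, still a nonzerodivisor. -/
lemma hom_ext (p : ℕ) [Fact p.Prime] {T : Scheme.{u}} (j : T ⟶ Spec (.of (ReesChart c.mem)))
    [Flat j] {f g : T ⟶ I.blowup} (hf : f ≫ I.blowupπ = j ≫ c.ι ≫ I.blowupπ ≫ L.ψ p)
    (hg : g ≫ I.blowupπ = j ≫ c.ι ≫ I.blowupπ ≫ L.ψ p) : f = g := by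
  refine I.blowup_hom_ext c.mem ((ReesChart.str c.mem).comp (L.frob c.isStable p)) ?_ j
    (hf.trans hg.symm) (hf.trans ?_)
  · rw [RingHom.comp_apply, c.frob_eq _ c.x_mem, map_pow]
    exact pow_mem (ReesChart.str_mem_nonZeroDivisors c.mem) _
  · rw [ι_π_assoc, ← L.specMap_frob_specι c.isStable, CommRingCat.ofHom_comp, Spec.map_comp,
      Category.assoc]

variable (L I) in
/-- The toric charts cover the blow-up. -/
def IsCovering : Prop := ∀ y : I.blowup, ∃ c : ToricChart L I, y ∈ Set.range c.ι

/-- The cover of the blow-up by toric charts. -/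
def cover (h : IsCovering L I) : I.blowup.OpenCover where
  I₀ := ToricChart L I
  X c := Spec (.of (ReesChart c.mem))
  f c := c.ι
  mem₀ := by
    rw [Scheme.presieve₀_mem_precoverage_iff]
    exact ⟨h, inferInstance⟩

/-- The overlap is open in, hence flat over, the chart `c`. Both sides lift the same map to `X`, so
`hom_ext` for `c` alone identifies them, with no relation between the generators of `c` and `d`. -/
lemma ψ_agree (c d : ToricChart L I) (p : ℕ) [Fact p.Prime] :
    pullback.fst c.ι d.ι ≫ c.ψ p ≫ c.ι = pullback.snd c.ι d.ι ≫ d.ψ p ≫ d.ι := by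
  have : IsOpenImmersion (pullback.fst c.ι d.ι) := inferInstance
  have : Flat (pullback.fst c.ι d.ι) := inferInstance
  refine c.hom_ext p (pullback.fst c.ι d.ι) ?_ ?_
  · rw [Category.assoc, Category.assoc, ψ_ι_π]
  · rw [Category.assoc, Category.assoc, ψ_ι_π, pullback.condition_assoc]

lemma blowup_hom_ext (h : IsCovering L I) {Y : Scheme.{u}} {f g : I.blowup ⟶ Y}
    (H : ∀ c : ToricChart L I, c.ι ≫ f = c.ι ≫ g) : f = g :=
  (cover h).hom_ext _ _ H

section

variable (h : IsCovering L I)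

/-- The morphism `ψ p` of the blow-up. -/
def blowupψ (p : ℕ) [Fact p.Prime] : I.blowup ⟶ I.blowup :=
  (cover h).glueMorphisms (fun c => c.ψ p ≫ c.ι) fun c d => ψ_agree c d p

lemma ι_blowupψ (p : ℕ) [Fact p.Prime] : c.ι ≫ blowupψ h p = c.ψ p ≫ c.ι :=
  (cover h).ι_glueMorphisms _ _ c

lemma ι_blowupψ_assoc (p : ℕ) [Fact p.Prime] {Z : Scheme.{u}} (k : I.blowup ⟶ Z) :
    c.ι ≫ blowupψ h p ≫ k = c.ψ p ≫ c.ι ≫ k := by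
  rw [← Category.assoc, ι_blowupψ, Category.assoc]

lemma blowupψ_π (p : ℕ) [Fact p.Prime] : blowupψ h p ≫ I.blowupπ = I.blowupπ ≫ L.ψ p :=
  blowup_hom_ext h fun c => by rw [ι_blowupψ_assoc, ψ_ι_π]

lemma blowupψ_comm (p q : ℕ) [Fact p.Prime] [Fact q.Prime] :
    blowupψ h p ≫ blowupψ h q = blowupψ h q ≫ blowupψ h p :=
  blowup_hom_ext h fun c => by
    rw [ι_blowupψ_assoc, ι_blowupψ_assoc, ι_blowupψ, ι_blowupψ, ← Category.assoc, ← Category.assoc,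
      ψ_comm]

end

lemma comp_σ (p : ℕ) [Fact p.Prime] {R : Type u} [CommRing R] [CharP R p]
    (g : ReesChart c.mem →+* R) : g.comp (c.σ p) = (frobenius R p).comp g :=
  ReesChart.lift_frobenius c.mem c.span_eq (c.σ_comp_str p) (fun y hy => c.frob_eq y hy p) c.x_mem g
    (L.comp_frob c.isStable p _)

lemma isFrobeniusLift_ψ (p : ℕ) [Fact p.Prime] : IsFrobeniusLift p (c.ψ p) := by
  intro R _ _ x
  obtain ⟨g, rfl⟩ := Spec.map_surjective x
  rw [ψ, ← Spec.map_comp, ← Spec.map_comp]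
  congr 1
  ext1
  exact c.comp_σ p g.hom

end ToricChart

/-- Being a Frobenius lift is local on the source. -/
lemma IsFrobeniusLift.of_openCover {p : ℕ} [Fact p.Prime] {Y : Scheme.{u}} (𝒰 : Y.OpenCover)
    {ψ : Y ⟶ Y} (ψ' : ∀ i, 𝒰.X i ⟶ 𝒰.X i) (hψ : ∀ i, 𝒰.f i ≫ ψ = ψ' i ≫ 𝒰.f i)
    (h : ∀ i, IsFrobeniusLift p (ψ' i)) : IsFrobeniusLift p ψ := by
  intro R _ _ x
  refine Scheme.hom_ext_of_forall _ _ fun t => ?_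
  obtain ⟨i, z, hz⟩ := 𝒰.exists_eq (x t)
  have ht : t ∈ x ⁻¹ᵁ (𝒰.f i).opensRange := ⟨z, hz⟩
  -- An `R`-valued point need not factor through one member of the cover, but it does so after
  -- localizing at a suitable `r` around `t`.
  obtain ⟨_, ⟨_, ⟨r, rfl⟩, rfl⟩, htr, hr⟩ :=
    (PrimeSpectrum.isBasis_basic_opens (R := R)).exists_subset_of_mem_open ht
      (x ⁻¹ᵁ (𝒰.f i).opensRange).isOpen
  let l : Spec (.of (Localization.Away r)) ⟶ Spec (.of R) :=
    Spec.map (CommRingCat.ofHom (algebraMap R (Localization.Away r)))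
  have : IsOpenImmersion l := IsOpenImmersion.of_isLocalization r
  have hl : Set.range l = (PrimeSpectrum.basicOpen r : Set (PrimeSpectrum R)) :=
    PrimeSpectrum.localization_away_comap_range (Localization.Away r) r
  obtain ⟨t', ht'⟩ : t ∈ Set.range l := hl ▸ htr
  -- Needed for `CharP _ p`: the zero ring would have characteristic 1.
  have : Nontrivial (Localization.Away r) := PrimeSpectrum.nontrivial t'
  have : CharP (Localization.Away r) p := (CharP.charP_iff_prime_eq_zero Fact.out).2 (by
    rw [← map_natCast (algebraMap R (Localization.Away r)), CharP.cast_eq_zero, map_zero])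
  let m : Spec (.of (Localization.Away r)) ⟶ 𝒰.X i := IsOpenImmersion.lift (𝒰.f i) (l ≫ x) (by
    rintro _ ⟨w, rfl⟩
    exact hr (hl ▸ ⟨w, rfl⟩))
  have hm : m ≫ 𝒰.f i = l ≫ x := IsOpenImmersion.lift_fac _ _ _
  have hfrob : l ≫ Spec.map (CommRingCat.ofHom (frobenius R p)) =
      Spec.map (CommRingCat.ofHom (frobenius (Localization.Away r) p)) ≫ l := by
    rw [← Spec.map_comp, ← Spec.map_comp]
    congr 1
    ext a
    exact map_pow (algebraMap R (Localization.Away r)) a p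
  have key : l ≫ x ≫ ψ = l ≫ Spec.map (CommRingCat.ofHom (frobenius R p)) ≫ x := by
    rw [← Category.assoc l (Spec.map _) x, hfrob, Category.assoc, ← hm, ← Category.assoc, ← hm,
      Category.assoc, hψ, ← Category.assoc,
      h i (Localization.Away r) m, Category.assoc]
  refine ⟨l.opensRange, ⟨t', ht'⟩, ?_⟩
  have hW : IsOpenImmersion.lift l l.opensRange.ι (by simp) ≫ l = l.opensRange.ι :=
    IsOpenImmersion.lift_fac _ _ _
  rw [← hW, Category.assoc, Category.assoc, key]

end

/-! ### Flatness, and distinguished opens in intersections of charts. -/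

noncomputable section

open Limits

namespace AlgebraicGeometry

/-- The terminal scheme is the spectrum of `ULift ℤ`, so flatness is transported along its
isomorphism with `ℤ`. -/
lemma flat_from_spec_iff (R : Type u) [CommRing R] :
    Flat (specULiftZIsTerminal.from (Spec (.of R))) ↔ Module.Flat ℤ R := by
  let e : ULift.{u} ℤ →+* ℤ := ULift.ringEquiv.toRingHom
  have he : Function.Bijective e := ULift.ringEquiv.bijective
  have h : specULiftZIsTerminal.from (Spec (.of R)) =
      Spec.map (CommRingCat.ofHom ((algebraMap ℤ R).comp e)) := specULiftZIsTerminal.hom_ext _ _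
  rw [h, Flat.SpecMap_iff, CommRingCat.hom_ofHom, RingHom.Flat.comp_iff_of_bijective_right he,
    RingHom.flat_algebraMap_iff]

/-- A distinguished open of an affine chart gives a distinguished open of the image of the chart. -/
lemma exists_basicOpen_eq_inf {R : Type u} [CommRing R] {Y : Scheme.{u}} (j : Spec (.of R) ⟶ Y)
    [IsOpenImmersion j] {O V : Y.Opens} (hV : V = j.opensRange) (e : R)
    (hO : j ⁻¹ᵁ O = PrimeSpectrum.basicOpen e) : ∃ F : Γ(Y, V), Y.basicOpen F = V ⊓ O := by
  rw [← Scheme.Hom.image_top_eq_opensRange] at hV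
  subst hV
  refine ⟨(j.appIso ⊤).inv ((Scheme.ΓSpecIso (.of R)).inv e), ?_⟩
  have he : (Spec (.of R)).basicOpen ((Scheme.ΓSpecIso (.of R)).inv e) = j ⁻¹ᵁ O :=
    (basicOpen_eq_of_affine (R := .of R) e).trans hO.symm
  rw [← Scheme.image_basicOpen]
  refine (congrArg (j ''ᵁ ·) he).trans ?_
  rw [Scheme.Hom.image_preimage_eq_opensRange_inf, Scheme.Hom.image_top_eq_opensRange]

namespace Scheme.IdealSheafData

variable {X : Scheme.{u}} (I : X.IdealSheafData)

lemma opensRange_chartι {U : X.affineOpens} {x : Γ(X, U.1)} (hx : x ∈ I.ideal U) :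
    (I.chartι hx).opensRange =
      I.blowupι U ''ᵁ Proj.basicOpen (reesGrading (I.ideal U)) (ReesChart.var hx) := by
  rw [← ReesChart.opensRange_ι]
  exact Scheme.Hom.opensRange_comp _ _

lemma opensRange_chartι_le {U : X.affineOpens} {x : Γ(X, U.1)} (hx : x ∈ I.ideal U) :
    (I.chartι hx).opensRange ≤ I.blowupπ ⁻¹ᵁ U.1 := by
  rw [opensRange_chartι, ← opensRange_blowupι]
  exact Scheme.Hom.image_le_opensRange _ _

/-- The part of a chart which lies over a distinguished open `W` of `U` is a chart over `W`. -/
lemma exists_opensRange_chartι_eq_inf {U W : X.affineOpens} {x : Γ(X, U.1)} (hx : x ∈ I.ideal U)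
    (f : Γ(X, U.1)) (hW : W = X.affineBasicOpen f) : ∃ (w : Γ(X, W.1)) (hw : w ∈ I.ideal W),
      (I.chartι hw).opensRange = (I.chartι hx).opensRange ⊓ I.blowupπ ⁻¹ᵁ W.1 := by
  subst hW
  have hI := I.map_ideal_basicOpen U f
  refine ⟨_, hI ▸ Ideal.mem_map_of_mem _ hx, ?_⟩
  rw [← opensRange_blowupι, inf_comm, ← Scheme.Hom.image_preimage_eq_opensRange_inf,
    I.opensRange_chartι hx]
  refine (I.opensRange_chartι _).trans ?_
  congr 1
  -- The `Proj` over `W` maps to the one over `U` with `x t` pulling back to its restriction times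
  -- `t`, so the basic opens correspond.
  rw [← I.projReesMap_blowupι U f]
  refine Eq.trans ?_ (((Scheme.Hom.comp_preimage _ _ _).trans (congrArg _
    (Scheme.Hom.preimage_image_eq _ _))).trans (Proj.map_preimage_basicOpen _ _ _)).symm
  congr 1
  exact Subtype.ext (Polynomial.map_monomial _).symm

/-- The intersection of two charts over the same affine open is a distinguished open of both. -/
lemma exists_basicOpen_eq_chartι_inf {W : X.affineOpens} {x y : Γ(X, W.1)} (hx : x ∈ I.ideal W)
    (hy : y ∈ I.ideal W) {V : I.blowup.Opens} (hV : V = (I.chartι hx).opensRange) :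
    ∃ F : Γ(I.blowup, V), I.blowup.basicOpen F = V ⊓ (I.chartι hy).opensRange := by
  -- The intersection is the locus in the chart of `x` where the ratio `y / x` is invertible.
  refine exists_basicOpen_eq_inf (I.chartι hx) hV
    (HomogeneousLocalization.Away.isLocalizationElem (𝒜 := reesGrading (I.ideal W))
      (ReesChart.var_mem hx) (ReesChart.var_mem hy)) ?_
  rw [opensRange_chartι, chartι, Scheme.Hom.comp_preimage, Scheme.Hom.preimage_image_eq]
  exact Proj.awayι_preimage_basicOpen (reesGrading (I.ideal W)) (ReesChart.var_mem hx) one_pos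
    (ReesChart.var_mem hy) one_pos

/-- The part of the intersection of two charts lying over a distinguished open of both affine opens
is a distinguished open of the first chart. -/
lemma exists_basicOpen_eq_chartι_inf_inf {U U' : X.affineOpens} {x : Γ(X, U.1)} {x' : Γ(X, U'.1)}
    (hx : x ∈ I.ideal U) (hx' : x' ∈ I.ideal U') {f : Γ(X, U.1)} {g : Γ(X, U'.1)}
    (hfg : X.basicOpen f = X.basicOpen g) : ∃ F : Γ(I.blowup, (I.chartι hx).opensRange),
      I.blowup.basicOpen F =
        (I.chartι hx).opensRange ⊓ (I.chartι hx').opensRange ⊓ I.blowupπ ⁻¹ᵁ X.basicOpen f := by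
  obtain ⟨w, hw, hw₁⟩ := I.exists_opensRange_chartι_eq_inf hx f rfl
  obtain ⟨w', hw', hw₁'⟩ := I.exists_opensRange_chartι_eq_inf (W := X.affineBasicOpen f) hx' g
    (Subtype.ext hfg)
  -- The pullback of `f` cuts out the chart of `x` over its basic open; there both charts live over
  -- one affine and a ratio `F₂` cuts out the rest. A distinguished open of a distinguished open of
  -- an affine is distinguished.
  let F₁ : Γ(I.blowup, (I.chartι hx).opensRange) :=
    I.blowupπ.appLE U.1 _ (I.opensRange_chartι_le hx) f
  have hF₁ : I.blowup.basicOpen F₁ = (I.chartι hw).opensRange :=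
    (Scheme.basicOpen_appLE _ _ _ _ _).trans hw₁.symm
  obtain ⟨F₂, hF₂⟩ := I.exists_basicOpen_eq_chartι_inf hw hw' hF₁
  obtain ⟨F, hF⟩ := (isAffineOpen_opensRange (I.chartι hx)).basicOpen_basicOpen_is_basicOpen F₁ F₂
  refine ⟨F, hF.trans (hF₂.trans ?_)⟩
  rw [hF₁, hw₁, hw₁']
  exact inf_inf_distrib_right _ _ _ |>.symm

/-- The charts given by generators of the ideal cover the part of the blow-up over `U`. -/
lemma exists_mem_opensRange_chartι {U : X.affineOpens} {s : Set Γ(X, U.1)}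
    (hs : Ideal.span s = I.ideal U) (y : I.blowup) (hy : I.blowupπ y ∈ U.1) :
    ∃ (x : Γ(X, U.1)) (hx : x ∈ I.ideal U), x ∈ s ∧ y ∈ (I.chartι hx).opensRange := by
  have hy' : y ∈ (I.blowupι U).opensRange := by rw [opensRange_blowupι]; exact hy
  obtain ⟨z, rfl⟩ := hy'
  have hsI (x : Γ(X, U.1)) (hx : x ∈ s) : x ∈ I.ideal U := hs ▸ Ideal.subset_span hx
  have htop := Proj.iSup_basicOpen_eq_top (reesGrading (I.ideal U)) _
    (ReesChart.irrelevant_le_span hs hsI)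
  have hz : z ∈ (⊤ : (Proj (reesGrading (I.ideal U))).Opens) := trivial
  rw [← htop, TopologicalSpace.Opens.mem_iSup] at hz
  obtain ⟨⟨x, hx⟩, hz⟩ := hz
  refine ⟨x, hsI x hx, hx, ?_⟩
  rw [opensRange_chartι]
  exact ⟨z, hz, rfl⟩

end Scheme.IdealSheafData

end AlgebraicGeometry

/-! ### The `Λ`-structure on the blow-up and its affine `Λ`-cover. -/

namespace FlatLambdaStructure

variable {X Y : Scheme.{u}}

lemma flat_sections (L : FlatLambdaStructure X) (U : X.affineOpens) : Module.Flat ℤ Γ(X, U.1) := by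
  rw [← flat_from_spec_iff, ← specULiftZIsTerminal.comp_from (X.specι U)]
  have := L.flat
  infer_instance

lemma IsStable.inf {L : FlatLambdaStructure X} {V W : X.Opens} (hV : L.IsStable V)
    (hW : L.IsStable W) : L.IsStable (V ⊓ W) :=
  fun p _ => inf_le_inf (hV p) (hW p)

lemma IsStable.preimage {L : FlatLambdaStructure X} {M : FlatLambdaStructure Y} {f : Y ⟶ X}
    (hf : M.IsEquivariant L f) {W : X.Opens} (hW : L.IsStable W) : M.IsStable (f ⁻¹ᵁ W) := by
  intro p _
  rw [← Scheme.Hom.comp_preimage, hf p, Scheme.Hom.comp_preimage]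
  exact fun y hy => hW p hy

end FlatLambdaStructure

namespace ToricChart

variable {X : Scheme.{u}} {L : FlatLambdaStructure X} {I : X.IdealSheafData}

/-- Over `ℤ`, flat and torsion-free are equivalent, and torsion-freeness passes to charts. -/
lemma flat (c : ToricChart L I) : Module.Flat ℤ (ReesChart c.mem) := by
  have := L.flat_sections c.U
  have := ReesChart.isTorsionFree c.mem
  infer_instance

variable (h : IsCovering L I)

/-- The `Λ`-structure of the blow-up. -/
def lambdaStructure : FlatLambdaStructure I.blowup where
  flat := by
    let P : MorphismProperty Scheme.{u} := @Flat
    have : HasRingHomProperty P RingHom.Flat := inferInstanceAs (HasRingHomProperty @Flat _)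
    refine IsZariskiLocalAtSource.of_openCover (P := P) (cover h) fun c => ?_
    change Flat _
    rw [specULiftZIsTerminal.comp_from]
    exact (flat_from_spec_iff _).2 (flat c)
  ψ p := blowupψ h p
  comm p q := blowupψ_comm h p q
  isFrobeniusLift p := .of_openCover (cover h) (fun c => ψ c p) (fun c => ι_blowupψ c h p)
    fun c => isFrobeniusLift_ψ c p

lemma isEquivariant_π : (lambdaStructure h).IsEquivariant L I.blowupπ :=
  fun p _ => blowupψ_π h p

lemma isStable_opensRange (c : ToricChart L I) :
    (lambdaStructure h).IsStable c.ι.opensRange := by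
  rintro p _ _ ⟨z, rfl⟩
  change blowupψ h p (c.ι z) ∈ c.ι.opensRange
  rw [← Scheme.Hom.comp_apply, ι_blowupψ, Scheme.Hom.comp_apply]
  exact ⟨_, rfl⟩

end ToricChart

lemma FlatLambdaStructure.IsAffineCover.IsLocallyToric.exists_chart {X : Scheme.{u}}
    {L : FlatLambdaStructure X} {ι : Type*} {U : ι → X.affineOpens} {hU : L.IsAffineCover U}
    {I : X.IdealSheafData} (htoric : hU.IsLocallyToric I) (y : I.blowup) :
    ∃ c : ToricChart L I, (∃ i, c.U = U i) ∧ y ∈ c.ι.opensRange := by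
  have hy : I.blowupπ y ∈ (⊤ : X.Opens) := trivial
  rw [← hU.iSup_eq_top, TopologicalSpace.Opens.mem_iSup] at hy
  obtain ⟨i, hi⟩ := hy
  obtain ⟨s, hs, hfrob⟩ := htoric i
  obtain ⟨x, hx, hxs, hy⟩ := I.exists_mem_opensRange_chartι hs y hi
  exact ⟨⟨U i, hU.isStable i, s, hs, hfrob, x, hxs⟩, ⟨i, rfl⟩, hy⟩

end

theorem mainTheorem4 {X : Scheme.{u}} (L : FlatLambdaStructure X)
    {ι : Type*} (U : ι → X.affineOpens) (hU : L.IsAffineCover U)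
    (I : X.IdealSheafData) (hcone : I.HasZFlatNormalCone) (htoric : hU.IsLocallyToric I) :
    ∃ M : FlatLambdaStructure I.blowup, M.IsEquivariant L I.blowupπ ∧
      ∃ (κ : Type u) (V : κ → I.blowup.affineOpens), M.IsAffineCover V := by
  have h : ToricChart.IsCovering L I := fun y =>
    let ⟨c, _, hc⟩ := htoric.exists_chart y
    ⟨c, hc⟩
  have hπ := ToricChart.isEquivariant_π h
  -- A toric chart may lie over any affine open `Λ`-subscheme. Only those over members of `U` are
  -- kept, since common stable distinguished opens are known for these. Indexing by charts also
  -- keeps `κ` in `Type u`, whatever the universe of `ι`.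
  refine ⟨ToricChart.lambdaStructure h, hπ, {c : ToricChart L I // ∃ i, c.U = U i},
    fun c => ⟨c.1.ι.opensRange, isAffineOpen_opensRange c.1.ι⟩, ?_, fun c => ?_, ?_⟩
  · refine top_le_iff.1 fun y _ => ?_
    obtain ⟨c, hc, hy⟩ := htoric.exists_chart y
    exact TopologicalSpace.Opens.mem_iSup.2 ⟨⟨c, hc⟩, hy⟩
  · exact ToricChart.isStable_opensRange h c.1
  · rintro ⟨c, i, hc⟩ ⟨d, j, hd⟩ y hyc hyd
    have hπc : I.blowupπ y ∈ c.U.1 := I.opensRange_chartι_le c.mem hyc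
    have hπd : I.blowupπ y ∈ d.U.1 := I.opensRange_chartι_le d.mem hyd
    obtain ⟨f, g, hf, hfg, hst⟩ : ∃ (f : Γ(X, c.U.1)) (g : Γ(X, d.U.1)),
        I.blowupπ y ∈ X.basicOpen f ∧ X.basicOpen f = X.basicOpen g ∧
          L.IsStable (X.basicOpen f) := by
      rw [hc] at hπc ⊢
      rw [hd] at hπd ⊢
      exact hU.exists_basicOpen i j _ hπc hπd
    -- The neighbourhood of `y` is the intersection of both charts with the preimage of `X.basicOpen
    -- f`. This is symmetric in `c` and `d`, so `F` and `G` cut out the same open, and it is stable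
    -- as an intersection of stable opens.
    obtain ⟨F, hF⟩ := I.exists_basicOpen_eq_chartι_inf_inf c.mem d.mem hfg
    obtain ⟨G, hG⟩ := I.exists_basicOpen_eq_chartι_inf_inf d.mem c.mem hfg.symm
    refine ⟨F, G, hF ▸ ⟨⟨hyc, hyd⟩, hf⟩, ?_, ?_⟩
    · refine hF.trans (Eq.trans ?_ hG.symm)
      rw [hfg]
      exact congrArg (· ⊓ _) (inf_comm _ _)
    · exact hF ▸ ((ToricChart.isStable_opensRange h c).inf
        (ToricChart.isStable_opensRange h d)).inf (.preimage hπ hst)
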